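/- Let $X=(X_1,\dots,X_d)$ be an infinitely divisible random vector in $\mathbb{R}^d$ without Gaussian component, $X\sim ID(\gamma,0,\nu)$, that is, for all $t\in\mathbb{R}^d$, $$\mathbb{E}e^{i\langle t,X\rangle}=\exp\Big\{i\langle t,\gamma\rangle+\int_{\mathbb{R}^d}\big(e^{i\langle t,u\rangle}-1-i\langle t,u\rangle\mathbf{1}_{\|u\|_2\le 1}\big)\,\nu(du)\Big\},$$ where $\gamma\in\mathbb{R}^d$ and $\nu$ is a positive Borel measure on $\mathbb{R}^d$ with $\nu(\{0\})=0$ and $\int(1\wedge\|u\|_2^2)\,\nu(du)<\infty$. Assume that $X_1,\dots,X_d$ are independent and that $\mathbb{E}e^{t\|X\|_2}<\infty$ for some $t>0$. Let $\tilde\nu_k$ be the Lévy measure of $X_k$, that is, the image of $\nu$ under $u\mapsto u_k$ restricted to $\mathbb{R}\setminus\{0\}$ (so that $\nu$ is the sum over $k$ of the copies of $\tilde\nu_k$ carried by the $k$-th coordinate axis). Let $e_1,\dots,e_d$ be the standard basis of $\mathbb{R}^d$, and let $f:\mathbb{R}^d\to\mathbb{R}$ and $b_1,\dots,b_d\in\mathbb{R}$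 be such that $$|f(x+ue_k)-f(x)|\le b_k|u|\qquad\text{for all }u\in\mathbb{R},\ x\in\mathbb{R}^d,\ k=1,\dots,d.$$ Let $M=\sup\{t>0:\ \mathbb{E}e^{tb_k|X_k|}<\infty\text{ for all }k=1,\dots,d\}\in(0,\infty]$ and, for $0\le t<M$, $$h_f(t)=\sup_{x\in\mathbb{R}^d}\sum_{k=1}^d\int_{\mathbb{R}}|f(x+ue_k)-f(x)|^2\,\frac{e^{tb_k|u|}-1}{b_k|u|}\,\tilde\nu_k(du),$$ where the $k$-th term is $0$ if $b_k=0$. Then $f(X)$ is integrable, $h_f$ is finite on $[0,M)$, and $$\mathbb{E}e^{t(f(X)-\mathbb{E}f(X))}\le\exp\Big(\int_0^t h_f(s)\,ds\Big)\qquad\text{for all }0\le t<M.$$ Moreover, for all $0<x<h_f(M^-):=\lim_{t\uparrow M}h_f(t)$, the function $h_f$ is injective on $[0,M)$ with $[0,x]\subseteq h_f([0,M))$, and its inverse $h_f^{-1}$ satisfies $$\mathbb{P}\big(f(X)-\mathbb{E}f(X)\ge x\big)\le\exp\Big(-\int_0^x h_f^{-1}(s)\,ds\Big).$$ -/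

import Mathlib

open MeasureTheory ProbabilityTheory Filter Set
open scoped ENNReal Topology

noncomputable section

/-- A Lévy measure on `ℝ^d`: a positive Borel measure without atom at the origin which integrates
`1 ∧ ‖u‖₂²`. -/
structure IsLevyMeasure {d : ℕ} (ν : Measure (EuclideanSpace ℝ (Fin d))) : Prop where
  no_atom : ν {0} = 0
  lintegral_lt_top : ∫⁻ u, ENNReal.ofReal (min 1 (‖u‖ ^ 2)) ∂ν < ∞

/-- The Lévy–Khintchine exponent of `ID(γ, 0, ν)` at `t`:
`i⟨t, γ⟩ + ∫ (e^{i⟨t, u⟩} - 1 - i⟨t, u⟩ 1_{‖u‖₂ ≤ 1}) ν(du)`. -/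
def levyExponent {d : ℕ} (γ : EuclideanSpace ℝ (Fin d)) (ν : Measure (EuclideanSpace ℝ (Fin d)))
    (t : EuclideanSpace ℝ (Fin d)) : ℂ :=
  Complex.I * ((inner ℝ t γ : ℝ) : ℂ) +
    ∫ u, (Complex.exp (Complex.I * ((inner ℝ t u : ℝ) : ℂ)) - 1 -
      {v : EuclideanSpace ℝ (Fin d) | ‖v‖ ≤ 1}.indicator
        (fun v => Complex.I * ((inner ℝ t v : ℝ) : ℂ)) u) ∂ν

/-- `X ∼ ID(γ, 0, ν)` under `P`: the vector `X` is infinitely divisible without Gaussian component,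
with drift `γ` and Lévy measure `ν`, that is, `E e^{i⟨t, X⟩} = exp (levyExponent γ ν t)`
for every `t`. -/
structure IsIDVector {Ω : Type*} [MeasurableSpace Ω] (P : Measure Ω) {d : ℕ}
    (X : Ω → EuclideanSpace ℝ (Fin d)) (γ : EuclideanSpace ℝ (Fin d))
    (ν : Measure (EuclideanSpace ℝ (Fin d))) : Prop where
  aemeasurable : AEMeasurable X P
  isLevyMeasure : IsLevyMeasure ν
  charFun_eq : ∀ t : EuclideanSpace ℝ (Fin d),
    ∫ ω, Complex.exp (Complex.I * ((inner ℝ t (X ω) : ℝ) : ℂ)) ∂P =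
      Complex.exp (levyExponent γ ν t)

/-- The one-dimensional Lévy measure `ν̃_k` of the `k`-th coordinate: the image of `ν` under
`u ↦ u_k`, with the mass at the origin removed. When `ν` is concentrated on the coordinate axes,
that is, `ν(dx) = ∑_k δ₀(dx₁)⋯δ₀(dx_{k-1}) ν̃_k(dx_k) δ₀(dx_{k+1})⋯δ₀(dx_d)` with `ν̃_k` without
atom at the origin, this is exactly the measure `ν̃_k` carried by the `k`-th axis. -/
def coordLevyMeasure {d : ℕ} (ν : Measure (EuclideanSpace ℝ (Fin d))) (k : Fin d) : Measure ℝ :=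
  (ν.map (fun u : EuclideanSpace ℝ (Fin d) => u k)).restrict {0}ᶜ

/-- `M = sup {t > 0 : ∀ k, E e^{t b_k |X_k|} < ∞}`, possibly `+∞`. -/
def expMomentBound {Ω : Type*} [MeasurableSpace Ω] (P : Measure Ω) {d : ℕ}
    (X : Ω → EuclideanSpace ℝ (Fin d)) (b : Fin d → ℝ) : EReal :=
  ⨆ t ∈ {t : ℝ | 0 < t ∧ ∀ k, Integrable (fun ω => Real.exp (t * b k * |X ω k|)) P}, (t : EReal)

/-- `h_f(t) = sup_x ∑_k ∫ |f(x + u e_k) - f(x)|² (e^{t b_k |u|} - 1) / (b_k |u|) ν̃_k(du)`,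
as an element of `[0, ∞]`. If `b_k = 0` then `f` is constant along `e_k` and the `k`-th term is
`0`. -/
def hfun {d : ℕ} (ν : Measure (EuclideanSpace ℝ (Fin d))) (b : Fin d → ℝ)
    (f : EuclideanSpace ℝ (Fin d) → ℝ) (t : ℝ) : ℝ≥0∞ :=
  ⨆ x : EuclideanSpace ℝ (Fin d), ∑ k, ∫⁻ u : ℝ,
    ENNReal.ofReal (|f (x + u • EuclideanSpace.single k (1 : ℝ)) - f x| ^ 2 *
      ((Real.exp (t * b k * |u|) - 1) / (b k * |u|))) ∂(coordLevyMeasure ν k)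

/-- The left limit `h(M⁻) = lim_{t ↑ M} h(t)` in `[0, ∞]`, `M` being allowed to be `+∞`; written as
an upper limit, which is the limit whenever the latter exists, in particular for nondecreasing
`h`. -/
def leftLimit (h : ℝ → ℝ≥0∞) (M : EReal) : ℝ≥0∞ :=
  limsup h (comap (fun t : ℝ => (t : EReal)) (𝓝[<] M))

end

/-! The engine is a covariance formula: for infinitely divisible laws without Gaussian part,
Cov(f(X), g(X)) is an average, over couplings (Y, Z) of two copies of X, of the integrals ∫ (f(Y+u)
- f(Y)) (g(Z+u) - g(Z)) ν(du). Only inequalities drawn from this formula are needed, so it is proved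
approximately. For a random walk, making the steps of two independent copies common one at a time
telescopes the covariance exactly (`walkLaw_cov_eq_sum`). A walk with rare jumps approximates a
compound Poisson law (`exists_coupling`), and compound Poisson laws with drift converge to the law
of X. Independence makes the characteristic function a product over coordinates, so that the
approximating jumps may be taken along the axes. `cov_le_of_jumpCov_le` and
`half_le_cov_of_le_jumpCov` are the upper and lower bounds which survive the limit.

The upper bound is applied to a truncation F of f and to g = e^{tF}. Monotonicity of a ↦ (e^{ta} -
1)/a and pq ≤ (p² + q²)/2 separate the increments at the two points (`mul_exp_increment_le`), whence
Cov(F, e^{tF}) ≤ h_f(t) E e^{tF}. This is a differential inequality for log E e^{tF}; integrating it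
and removing the truncation by Fatou's lemma gives the Laplace bound.

The lower bound, applied to truncations of a coordinate and of its exponential, shows that an
exponential moment of X_k forces the same moment for the large jumps of ν in direction k. Hence h_f
is finite on [0, M). Convexity and h_f(0) = 0 make it continuous there, and strictly increasing
unless it vanishes identically. The tail bound is Chernoff's inequality at h_f^{-1}(x), combined
with the equality case of Young's inequality. -/

set_option linter.unusedSectionVars false

/-! ### Random walks, couplings by shared steps, and telescoping of covariances -/

/-- The law after `n` steps of the random walk with initial law `μ₀` and step law `ρ`. -/
noncomputable def walkLaw {M : Type*} [AddMonoid M] [MeasurableSpace M] (ρ μ₀ : Measure M) :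
    ℕ → Measure M
  | 0 => μ₀
  | n + 1 => (walkLaw ρ μ₀ n).conv ρ

section WalkLaw

variable {M : Type*} [AddCommMonoid M] [MeasurableSpace M] [MeasurableAdd₂ M]

instance prodMeasurableAdd₂ : MeasurableAdd₂ (M × M) where
  measurable_add :=
    (measurable_fst.fst.add measurable_snd.fst).prodMk (measurable_fst.snd.add measurable_snd.snd)

instance walkLaw.isProbabilityMeasure (ρ μ₀ : Measure M) [IsProbabilityMeasure ρ]
    [IsProbabilityMeasure μ₀] (n : ℕ) : IsProbabilityMeasure (walkLaw ρ μ₀ n) := by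
  induction n with
  | zero => assumption
  | succ n ih => exact Measure.probabilitymeasure_of_probabilitymeasures_conv _ _

/-- By commutativity, an independent increment may be added before or after the walk. -/
lemma walkLaw_conv (ρ μ₀ σ : Measure M) [IsProbabilityMeasure ρ] [IsProbabilityMeasure μ₀]
    [IsProbabilityMeasure σ] (n : ℕ) :
    walkLaw ρ (μ₀.conv σ) n = (walkLaw ρ μ₀ n).conv σ := by
  induction n with
  | zero => rfl
  | succ n ih =>
    rw [walkLaw, ih, walkLaw, Measure.conv_assoc, Measure.conv_assoc, Measure.conv_comm σ ρ]

lemma walkLaw_add (ρ μ₀ : Measure M) (i j : ℕ) :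
    walkLaw ρ (walkLaw ρ μ₀ j) i = walkLaw ρ μ₀ (j + i) := by
  induction i with
  | zero => rfl
  | succ i ih => rw [walkLaw, ih, ← add_assoc, walkLaw]

lemma map_walkLaw {M' : Type*} [AddCommMonoid M'] [MeasurableSpace M'] [MeasurableAdd₂ M']
    (ρ μ₀ : Measure M) [IsProbabilityMeasure ρ] [IsProbabilityMeasure μ₀] (L : M →+ M')
    (hL : Measurable L) (n : ℕ) :
    (walkLaw ρ μ₀ n).map L = walkLaw (ρ.map L) (μ₀.map L) n := by
  induction n with
  | zero => rfl
  | succ n ih => rw [walkLaw, Measure.map_conv_addMonoidHom L hL, ih, walkLaw]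

lemma prod_conv_prod (μ ν ρ σ : Measure M) [IsProbabilityMeasure μ] [IsProbabilityMeasure ν]
    [IsProbabilityMeasure ρ] [IsProbabilityMeasure σ] :
    (μ.prod ν).conv (ρ.prod σ) = (μ.conv ρ).prod (ν.conv σ) := by
  refine (Measure.prod_eq fun s t hs ht => ?_).symm
  rw [← lintegral_indicator_one (hs.prod ht), ← lintegral_indicator_one hs,
    ← lintegral_indicator_one ht,
    Measure.lintegral_conv (measurable_one.indicator (hs.prod ht)),
    Measure.lintegral_conv (measurable_one.indicator hs),
    Measure.lintegral_conv (measurable_one.indicator ht)]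
  have h1 : ∀ x y : M × M, (s ×ˢ t).indicator (1 : M × M → ℝ≥0∞) (x + y) =
      s.indicator 1 (x.1 + y.1) * t.indicator 1 (x.2 + y.2) := by
    classical
    intro x y
    simp only [indicator_apply, mem_prod, Prod.fst_add, Prod.snd_add, Pi.one_apply]
    by_cases hx : x.1 + y.1 ∈ s <;> by_cases hy : x.2 + y.2 ∈ t <;> simp [hx, hy]
  have m1 : Measurable fun p : M × M => s.indicator (1 : M → ℝ≥0∞) (p.1 + p.2) :=
    (measurable_one.indicator hs).comp measurable_add
  have m2 : Measurable fun p : M × M => t.indicator (1 : M → ℝ≥0∞) (p.1 + p.2) :=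
    (measurable_one.indicator ht).comp measurable_add
  simp_rw [h1]
  have h2 : ∀ x : M × M, ∫⁻ y, s.indicator (1 : M → ℝ≥0∞) (x.1 + y.1) *
      t.indicator (1 : M → ℝ≥0∞) (x.2 + y.2) ∂(ρ.prod σ) =
      (∫⁻ y, s.indicator (1 : M → ℝ≥0∞) (x.1 + y) ∂ρ) *
        ∫⁻ y, t.indicator (1 : M → ℝ≥0∞) (x.2 + y) ∂σ := fun x =>
    lintegral_prod_mul (m1.comp measurable_prodMk_left).aemeasurable
      (m2.comp measurable_prodMk_left).aemeasurable
  simp_rw [h2]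
  exact lintegral_prod_mul m1.lintegral_prod_right'.aemeasurable
    m2.lintegral_prod_right'.aemeasurable

lemma walkLaw_prod (ρ μ₀ ρ' μ₀' : Measure M) [IsProbabilityMeasure ρ] [IsProbabilityMeasure μ₀]
    [IsProbabilityMeasure ρ'] [IsProbabilityMeasure μ₀'] (n : ℕ) :
    walkLaw (ρ.prod ρ') (μ₀.prod μ₀') n = (walkLaw ρ μ₀ n).prod (walkLaw ρ' μ₀' n) := by
  induction n with
  | zero => rfl
  | succ n ih => rw [walkLaw, ih, prod_conv_prod, walkLaw, walkLaw]

/-- The law of `(a + Z + U, a + Z + V)`, where `Z` is a sum of `i` steps and `U`, `V` are sums of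
`j` steps, all steps being independent with law `ρ`. -/
noncomputable def coupledLaw (ρ : Measure M) (a : M) (i j : ℕ) : Measure (M × M) :=
  walkLaw (ρ.map fun u => (u, u)) (walkLaw (ρ.prod ρ) (Measure.dirac (a, a)) j) i

variable (ρ : Measure M) [IsProbabilityMeasure ρ] (a : M)

instance isProbabilityMeasure_map_diag : IsProbabilityMeasure (ρ.map fun u => (u, u)) :=
  Measure.isProbabilityMeasure_map (by fun_prop)

instance coupledLaw.isProbabilityMeasure (i j : ℕ) :
    IsProbabilityMeasure (coupledLaw ρ a i j) := by
  unfold coupledLaw; infer_instance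

lemma coupledLaw_succ_left (i j : ℕ) :
    coupledLaw ρ a (i + 1) j = (coupledLaw ρ a i j).conv (ρ.map fun u => (u, u)) := rfl

lemma coupledLaw_succ_right (i j : ℕ) :
    coupledLaw ρ a i (j + 1) = (coupledLaw ρ a i j).conv (ρ.prod ρ) :=
  walkLaw_conv _ _ _ _

lemma map_fst_coupledLaw (i j : ℕ) :
    (coupledLaw ρ a i j).map Prod.fst = walkLaw ρ (Measure.dirac a) (j + i) := by
  have h1 : (ρ.map fun u => (u, u)).map (AddMonoidHom.fst M M) = ρ := by
    rw [AddMonoidHom.coe_fst, Measure.map_map measurable_fst (by fun_prop)]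
    exact Measure.map_id
  have h2 : (ρ.prod ρ).map (AddMonoidHom.fst M M) = ρ := by
    simp
  have h3 : (Measure.dirac (a, a)).map (AddMonoidHom.fst M M) = Measure.dirac a :=
    Measure.map_dirac' measurable_fst _
  have := map_walkLaw (ρ.map fun u => (u, u)) (walkLaw (ρ.prod ρ) (Measure.dirac (a, a)) j)
    (AddMonoidHom.fst M M) measurable_fst i
  rw [map_walkLaw (ρ.prod ρ) (Measure.dirac (a, a)) _ measurable_fst j, h1, h2, h3, walkLaw_add] at this
  exact this

lemma map_snd_coupledLaw (i j : ℕ) :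
    (coupledLaw ρ a i j).map Prod.snd = walkLaw ρ (Measure.dirac a) (j + i) := by
  have h1 : (ρ.map fun u => (u, u)).map (AddMonoidHom.snd M M) = ρ := by
    rw [AddMonoidHom.coe_snd, Measure.map_map measurable_snd (by fun_prop)]
    exact Measure.map_id
  have h2 : (ρ.prod ρ).map (AddMonoidHom.snd M M) = ρ := by
    simp
  have h3 : (Measure.dirac (a, a)).map (AddMonoidHom.snd M M) = Measure.dirac a :=
    Measure.map_dirac' measurable_snd _
  have := map_walkLaw (ρ.map fun u => (u, u)) (walkLaw (ρ.prod ρ) (Measure.dirac (a, a)) j)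
    (AddMonoidHom.snd M M) measurable_snd i
  rw [map_walkLaw (ρ.prod ρ) (Measure.dirac (a, a)) _ measurable_snd j, h1, h2, h3, walkLaw_add] at this
  exact this

lemma coupledLaw_zero_right (n : ℕ) :
    coupledLaw ρ a n 0 = (walkLaw ρ (Measure.dirac a) n).map fun x => (x, x) := by
  have := map_walkLaw ρ (Measure.dirac a) ((AddMonoidHom.id M).prod (AddMonoidHom.id M))
    (measurable_id.prodMk measurable_id) n
  have h3 : (Measure.dirac a).map ((AddMonoidHom.id M).prod (AddMonoidHom.id M)) =
      Measure.dirac (a, a) := Measure.map_dirac' (measurable_id.prodMk measurable_id) _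
  rw [h3] at this
  exact this.symm

lemma coupledLaw_zero_left (n : ℕ) :
    coupledLaw ρ a 0 n =
      (walkLaw ρ (Measure.dirac a) n).prod (walkLaw ρ (Measure.dirac a) n) := by
  rw [← walkLaw_prod, Measure.dirac_prod_dirac]
  rfl

/-- With all n steps shared the two positions coincide and E f(p₁) g(p₂) is the mean of the product;
with none shared they are independent and it is the product of the means. Turning one independent
pair of steps into a shared step changes the expectation by a one-step covariance, taken at the two
positions reached by the other n - 1 steps. -/
lemma walkLaw_cov_eq_sum {f g : M → ℝ} (hf : Measurable f) (hg : Measurable g) {A B : ℝ}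
    (hfA : ∀ x, |f x| ≤ A) (hgB : ∀ x, |g x| ≤ B) (n : ℕ) :
    ∫ x, f x * g x ∂(walkLaw ρ (Measure.dirac a) n) -
      (∫ x, f x ∂(walkLaw ρ (Measure.dirac a) n)) * ∫ x, g x ∂(walkLaw ρ (Measure.dirac a) n) =
    ∑ i ∈ Finset.range n, ∫ p, (∫ u, f (p.1 + u) * g (p.2 + u) ∂ρ -
      (∫ u, f (p.1 + u) ∂ρ) * ∫ u, g (p.2 + u) ∂ρ) ∂(coupledLaw ρ a i (n - 1 - i)) := by
  have hFm : Measurable fun p : M × M => f p.1 * g p.2 := by fun_prop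
  have hB : ∀ p : M × M, ‖f p.1 * g p.2‖ ≤ A * B := fun p => by
    rw [norm_mul]
    exact mul_le_mul (hfA _) (hgB _) (norm_nonneg _) ((abs_nonneg _).trans (hfA p.1))
  have hint : ∀ (μ : Measure (M × M)) [IsProbabilityMeasure μ],
      Integrable (fun p : M × M => f p.1 * g p.2) μ := fun μ _ =>
    Integrable.of_bound hFm.aestronglyMeasurable _ (ae_of_all _ hB)
  have hconv : ∀ (μ ν : Measure (M × M)) [IsProbabilityMeasure μ] [IsProbabilityMeasure ν],
      ∫ p, f p.1 * g p.2 ∂(μ.conv ν) = ∫ p, ∫ q, f (p.1 + q.1) * g (p.2 + q.2) ∂ν ∂μ := by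
    intro μ ν _ _
    rw [integral_conv (hint _)]
    rfl
  have h2 : ∀ (μ ν : Measure (M × M)) [IsProbabilityMeasure μ] [IsProbabilityMeasure ν],
      Integrable (fun p => ∫ q, f (p.1 + q.1) * g (p.2 + q.2) ∂ν) μ := by
    intro μ ν _ _
    have : Integrable (fun z : (M × M) × (M × M) => f (z.1.1 + z.2.1) * g (z.1.2 + z.2.2))
        (μ.prod ν) := by
      refine Integrable.of_bound (Measurable.aestronglyMeasurable (by fun_prop)) (A * B)
        (ae_of_all _ fun z => hB (z.1 + z.2))
    exact this.integral_prod_left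
  set a' : ℕ → ℝ := fun i => ∫ p, f p.1 * g p.2 ∂(coupledLaw ρ a i (n - i)) with ha'
  have e1 : ∫ x, f x * g x ∂(walkLaw ρ (Measure.dirac a) n) = a' n := by
    simp only [ha', Nat.sub_self, coupledLaw_zero_right]
    rw [integral_map (by fun_prop) hFm.aestronglyMeasurable]
  have e2 : (∫ x, f x ∂(walkLaw ρ (Measure.dirac a) n)) *
      ∫ x, g x ∂(walkLaw ρ (Measure.dirac a) n) = a' 0 := by
    simp only [ha', Nat.sub_zero, coupledLaw_zero_left]
    rw [integral_prod_mul]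
  rw [e1, e2, ← Finset.sum_range_sub]
  refine Finset.sum_congr rfl fun i hi => ?_
  have hi' : i < n := Finset.mem_range.1 hi
  obtain ⟨j, rfl⟩ : ∃ j, n = i + 1 + j := ⟨n - (i + 1), by omega⟩
  have s1 : i + 1 + j - (i + 1) = j := by omega
  have s2 : i + 1 + j - i = j + 1 := by omega
  have s3 : i + 1 + j - 1 - i = j := by omega
  simp only [ha', s1, s2, s3]
  -- Both laws are the same coupling of n - 1 steps followed by one more step, shared in the first
  -- and independent in the second.
  rw [coupledLaw_succ_left, coupledLaw_succ_right, hconv, hconv, ← integral_sub (h2 _ _) (h2 _ _)]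
  refine integral_congr_ae (ae_of_all _ fun p => ?_)
  dsimp only
  congr 1
  · rw [integral_map (by fun_prop) (Measurable.aestronglyMeasurable (by fun_prop))]
  · rw [← integral_prod_mul]

end WalkLaw

/-! ### Walks with rare jumps: one-step covariances and the mean coupling -/

lemma abs_integral_le_of_abs_le {α : Type*} [MeasurableSpace α] (μ : Measure α)
    [IsFiniteMeasure μ] {f : α → ℝ} {C : ℝ} (h : ∀ x, |f x| ≤ C) :
    |∫ x, f x ∂μ| ≤ C * μ.real univ := by
  have := norm_integral_le_of_norm_le_const (μ := μ) (f := f) (ae_of_all _ h)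
  rwa [Real.norm_eq_abs] at this

/-- The integral `∫ (f (x + u) - f x) (g (y + u) - g y) κ(du)` of the product of the increments of
`f` at `x` and of `g` at `y`. -/
noncomputable def jumpCov {M : Type*} [AddMonoid M] [MeasurableSpace M] (κ : Measure M)
    (f g : M → ℝ) (x y : M) : ℝ :=
  ∫ u, (f (x + u) - f x) * (g (y + u) - g y) ∂κ

/-- The law of a step which is `0` with probability `1 - κ(M) / n` and is drawn from `κ / n`
otherwise. -/
noncomputable def lazyStep {M : Type*} [AddMonoid M] [MeasurableSpace M] (κ : Measure M) (n : ℕ) :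
    Measure M :=
  ENNReal.ofReal (1 - κ.real univ / n) • Measure.dirac 0 + ENNReal.ofReal (1 / n) • κ

section LazyStep

variable {M : Type*} [AddCommMonoid M] [MeasurableSpace M] [MeasurableAdd₂ M]
  {κ : Measure M} [IsFiniteMeasure κ] {n : ℕ}

lemma isProbabilityMeasure_lazyStep (hn : 0 < n) (hκ : κ.real univ ≤ n) :
    IsProbabilityMeasure (lazyStep κ n) := by
  have hn' : (0 : ℝ) < n := Nat.cast_pos.2 hn
  have h0 : 0 ≤ κ.real univ := measureReal_nonneg
  refine ⟨?_⟩
  have : κ univ = ENNReal.ofReal (κ.real univ) := (ofReal_measureReal).symm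
  simp only [lazyStep, Measure.add_apply, Measure.smul_apply, measure_univ, smul_eq_mul, mul_one]
  rw [this, ← ENNReal.ofReal_mul (by positivity), ← ENNReal.ofReal_add _ (by positivity)]
  · rw [← ENNReal.ofReal_one]
    congr 1
    field_simp
    ring
  · rw [sub_nonneg, div_le_one hn']
    exact hκ

lemma integral_lazyStep {F : Type*} [NormedAddCommGroup F] [NormedSpace ℝ F] [CompleteSpace F]
    (hn : 0 < n) (hκ : κ.real univ ≤ n) {f : M → F} (hf : StronglyMeasurable f) {C : ℝ}
    (hC : ∀ x, ‖f x‖ ≤ C) :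
    ∫ x, f x ∂(lazyStep κ n) =
      (1 - κ.real univ / n) • f 0 + (1 / (n : ℝ)) • ∫ x, f x ∂κ := by
  have hn' : (0 : ℝ) < n := Nat.cast_pos.2 hn
  have h1 : 0 ≤ 1 - κ.real univ / n := by
    rw [sub_nonneg, div_le_one hn']
    exact hκ
  have hi : ∀ (μ : Measure M) [IsFiniteMeasure μ], Integrable f μ := fun μ _ =>
    Integrable.of_bound hf.aestronglyMeasurable C (ae_of_all _ hC)
  rw [lazyStep, integral_add_measure ((hi _).smul_measure ENNReal.ofReal_ne_top)
    ((hi _).smul_measure ENNReal.ofReal_ne_top), integral_smul_measure, integral_smul_measure,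
    integral_dirac' _ _ hf, ENNReal.toReal_ofReal h1, ENNReal.toReal_ofReal (by positivity)]

/-- The last step carries at least this mass at 0, and then leaves the position unchanged. -/
lemma smul_walkLaw_le_walkLaw_succ (hn : 0 < n) (hκ : κ.real univ ≤ n) (a : M) (m : ℕ) :
    ENNReal.ofReal (1 - κ.real univ / n) • walkLaw (lazyStep κ n) (Measure.dirac a) m ≤
      walkLaw (lazyStep κ n) (Measure.dirac a) (m + 1) := by
  have := isProbabilityMeasure_lazyStep hn hκ
  set μ := walkLaw (lazyStep κ n) (Measure.dirac a) m with hμ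
  rw [walkLaw, ← hμ]
  refine Measure.le_iff.2 fun s hs => ?_
  rw [← lintegral_indicator_one hs, ← lintegral_indicator_one hs,
    Measure.lintegral_conv (measurable_one.indicator hs), lintegral_smul_measure, smul_eq_mul,
    ← lintegral_const_mul _ (measurable_one.indicator hs)]
  refine lintegral_mono fun x => ?_
  have hm : Measurable fun y => s.indicator (1 : M → ℝ≥0∞) (x + y) :=
    (measurable_one.indicator hs).comp (measurable_const_add x)
  dsimp only
  rw [lazyStep, lintegral_add_measure, lintegral_smul_measure, lintegral_dirac' _ hm, add_zero,
    smul_eq_mul]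
  exact le_self_add

lemma abs_lazyStep_cov_sub_jumpCov_le (hn : 0 < n) (hκ : κ.real univ ≤ n) {f g : M → ℝ}
    (hf : Measurable f) (hg : Measurable g) {A B : ℝ} (hfA : ∀ x, |f x| ≤ A)
    (hgB : ∀ x, |g x| ≤ B) (x y : M) :
    |(∫ u, f (x + u) * g (y + u) ∂(lazyStep κ n) -
      (∫ u, f (x + u) ∂(lazyStep κ n)) * ∫ u, g (y + u) ∂(lazyStep κ n)) -
      (1 - κ.real univ / n) / n * jumpCov κ f g x y| ≤ 2 * (κ.real univ / n) ^ 2 * (A * B) := by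
  have hn' : (0 : ℝ) < n := Nat.cast_pos.2 hn
  have h0 : 0 ≤ κ.real univ := measureReal_nonneg
  have hA : 0 ≤ A := (abs_nonneg _).trans (hfA x)
  have hB : 0 ≤ B := (abs_nonneg _).trans (hgB x)
  have hAB : ∀ u, ‖f (x + u) * g (y + u)‖ ≤ A * B := fun u => by
    rw [norm_mul]
    exact mul_le_mul (hfA _) (hgB _) (norm_nonneg _) hA
  have mf : Measurable fun u => f (x + u) := hf.comp (measurable_const_add x)
  have mg : Measurable fun u => g (y + u) := hg.comp (measurable_const_add y)
  have i1 : Integrable (fun u => f (x + u)) κ :=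
    Integrable.of_bound mf.aestronglyMeasurable A (ae_of_all _ fun u => hfA _)
  have i2 : Integrable (fun u => g (y + u)) κ :=
    Integrable.of_bound mg.aestronglyMeasurable B (ae_of_all _ fun u => hgB _)
  have i3 : Integrable (fun u => f (x + u) * g (y + u)) κ :=
    Integrable.of_bound (mf.mul mg).aestronglyMeasurable _ (ae_of_all _ hAB)
  rw [integral_lazyStep (f := fun u => f (x + u) * g (y + u)) hn hκ
      (mf.mul mg).stronglyMeasurable hAB,
    integral_lazyStep hn hκ mf.stronglyMeasurable (fun u => hfA _),
    integral_lazyStep hn hκ mg.stronglyMeasurable (fun u => hgB _)]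
  have hΓ : jumpCov κ f g x y = ∫ u, f (x + u) * g (y + u) ∂κ - f x * ∫ u, g (y + u) ∂κ -
      g y * ∫ u, f (x + u) ∂κ + κ.real univ * (f x * g y) := by
    have : ∀ u, (f (x + u) - f x) * (g (y + u) - g y) =
        f (x + u) * g (y + u) - f x * g (y + u) - g y * f (x + u) + f x * g y := fun u => by ring
    rw [jumpCov]
    simp_rw [this]
    have i4 : Integrable (fun u => f (x + u) * g (y + u) - f x * g (y + u)) κ :=
      i3.sub (i2.const_mul _)
    have i5 : Integrable (fun u => f (x + u) * g (y + u) - f x * g (y + u) - g y * f (x + u)) κ :=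
      i4.sub (i1.const_mul _)
    rw [integral_add i5 (integrable_const _), integral_sub i4 (i1.const_mul _),
      integral_sub i3 (i2.const_mul _),
      integral_const_mul, integral_const_mul, integral_const, smul_eq_mul]
  rw [hΓ]
  set a := ∫ u, f (x + u) ∂κ with ha
  set b := ∫ u, g (y + u) ∂κ with hb
  set c := ∫ u, f (x + u) * g (y + u) ∂κ with hc
  set l := κ.real univ
  have ba : |a| ≤ A * l := abs_integral_le_of_abs_le _ fun u => hfA _
  have bb : |b| ≤ B * l := abs_integral_le_of_abs_le _ fun u => hgB _
  have bc : |c| ≤ A * B * l := abs_integral_le_of_abs_le _ hAB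
  simp only [smul_eq_mul, add_zero]
  -- The factor 1 - l/n in front of the jump covariance cancels all terms of order 1/n and leaves an
  -- exact remainder of order 1/n².
  have e : (1 - l / n) * (f x * g y) + 1 / n * c -
      ((1 - l / n) * f x + 1 / n * a) * ((1 - l / n) * g y + 1 / n * b) -
      (1 - l / n) / n * (c - f x * b - g y * a + l * (f x * g y)) =
      (l * c - a * b) / n ^ 2 := by
    field_simp
    ring
  rw [e, abs_div, abs_of_pos (by positivity : (0 : ℝ) < (n : ℝ) ^ 2), div_le_iff₀ (by positivity)]
  have e2 : 2 * (l / n) ^ 2 * (A * B) * (n : ℝ) ^ 2 = 2 * l ^ 2 * (A * B) := by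
    field_simp
  rw [e2]
  calc |l * c - a * b| ≤ |l * c| + |a * b| := abs_sub _ _
    _ = l * |c| + |a| * |b| := by rw [abs_mul, abs_mul, abs_of_nonneg h0]
    _ ≤ l * (A * B * l) + (A * l) * (B * l) := by gcongr
    _ = 2 * l ^ 2 * (A * B) := by ring

lemma stronglyMeasurable_jumpCov {f g : M → ℝ} (hf : Measurable f) (hg : Measurable g) :
    StronglyMeasurable fun p : M × M => jumpCov κ f g p.1 p.2 := by
  refine StronglyMeasurable.integral_prod_right' (f := fun z : (M × M) × M =>
    (f (z.1.1 + z.2) - f z.1.1) * (g (z.1.2 + z.2) - g z.1.2)) ?_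
  exact Measurable.stronglyMeasurable (by fun_prop)

lemma abs_jumpCov_le {f g : M → ℝ} {A B : ℝ} (hfA : ∀ x, |f x| ≤ A) (hgB : ∀ x, |g x| ≤ B)
    (x y : M) : |jumpCov κ f g x y| ≤ 2 * A * (2 * B) * κ.real univ := by
  refine abs_integral_le_of_abs_le _ fun u => ?_
  rw [abs_mul]
  have h1 : |f (x + u) - f x| ≤ 2 * A :=
    (abs_sub _ _).trans (by linarith [hfA x, hfA (x + u)])
  have h2 : |g (y + u) - g y| ≤ 2 * B :=
    (abs_sub _ _).trans (by linarith [hgB y, hgB (y + u)])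
  exact mul_le_mul h1 h2 (abs_nonneg _) ((abs_nonneg _).trans h1)

/-- The average of the couplings of two positions of the walk which share their first steps. -/
noncomputable def meanCoupling (κ : Measure M) (a : M) (n : ℕ) : Measure (M × M) :=
  ENNReal.ofReal ((1 - κ.real univ / n) / n) •
    ∑ i ∈ Finset.range n, coupledLaw (lazyStep κ n) a i (n - 1 - i)

/-- Every coupling in the average has the law of n - 1 steps as marginal, and the weight 1 - κ(M)/n
is exactly the price for passing from n - 1 to n steps. Domination of the marginals is enough to
bound integrals of nonnegative functions of one position. -/
lemma meanCoupling_map_le (hn : 0 < n) (hκ : κ.real univ ≤ n) (a : M) {φ : M × M → M}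
    (hφ : Measurable φ) (h : ∀ i j, (coupledLaw (lazyStep κ n) a i j).map φ =
      walkLaw (lazyStep κ n) (Measure.dirac a) (j + i)) :
    (meanCoupling κ a n).map φ ≤ walkLaw (lazyStep κ n) (Measure.dirac a) n := by
  have hn' : (0 : ℝ) < n := Nat.cast_pos.2 hn
  have e1 : (meanCoupling κ a n).map φ = ENNReal.ofReal (1 - κ.real univ / n) •
      walkLaw (lazyStep κ n) (Measure.dirac a) (n - 1) := by
    ext s hs
    rw [Measure.map_apply hφ hs, meanCoupling, Measure.smul_apply, Measure.finsetSum_apply]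
    have : ∀ i ∈ Finset.range n, coupledLaw (lazyStep κ n) a i (n - 1 - i) (φ ⁻¹' s) =
        walkLaw (lazyStep κ n) (Measure.dirac a) (n - 1) s := fun i hi => by
      rw [← Measure.map_apply hφ hs, h]
      congr 2
      have := Finset.mem_range.1 hi
      omega
    rw [Finset.sum_congr rfl this, Finset.sum_const, Finset.card_range, Measure.smul_apply,
      smul_eq_mul, smul_eq_mul, nsmul_eq_mul, ← mul_assoc, ← ENNReal.ofReal_natCast,
      ← ENNReal.ofReal_mul' (by positivity), div_mul_cancel₀ _ hn'.ne']
  rw [e1]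
  have := smul_walkLaw_le_walkLaw_succ hn hκ a (n - 1)
  rwa [Nat.sub_add_cancel hn] at this

lemma meanCoupling_real_univ (hn : 0 < n) (hκ : κ.real univ ≤ n) (a : M) :
    (meanCoupling κ a n).real univ = 1 - κ.real univ / n := by
  have hn' : (0 : ℝ) < n := Nat.cast_pos.2 hn
  have := isProbabilityMeasure_lazyStep hn hκ
  have h1 : 0 ≤ 1 - κ.real univ / n := by
    rw [sub_nonneg, div_le_one hn']
    exact hκ
  rw [Measure.real, meanCoupling, Measure.smul_apply, Measure.finsetSum_apply]
  simp only [measure_univ, Finset.sum_const, Finset.card_range, smul_eq_mul, nsmul_eq_mul, mul_one]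
  rw [ENNReal.toReal_mul, ENNReal.toReal_ofReal (by positivity), ENNReal.toReal_natCast,
    div_mul_cancel₀ _ hn'.ne']

/-- Each of the n terms of the telescoping sum contributes an error of order 1/n². -/
lemma abs_walkLaw_cov_sub_le (hn : 0 < n) (hκ : κ.real univ ≤ n) (a : M) {f g : M → ℝ}
    (hf : Measurable f) (hg : Measurable g) {A B : ℝ} (hfA : ∀ x, |f x| ≤ A)
    (hgB : ∀ x, |g x| ≤ B) :
    |(∫ x, f x * g x ∂(walkLaw (lazyStep κ n) (Measure.dirac a) n) -
      (∫ x, f x ∂(walkLaw (lazyStep κ n) (Measure.dirac a) n)) *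
        ∫ x, g x ∂(walkLaw (lazyStep κ n) (Measure.dirac a) n)) -
      ∫ p, jumpCov κ f g p.1 p.2 ∂(meanCoupling κ a n)| ≤
      2 * (κ.real univ) ^ 2 / n * (A * B) := by
  have hn' : (0 : ℝ) < n := Nat.cast_pos.2 hn
  have := isProbabilityMeasure_lazyStep hn hκ
  have h1 : 0 ≤ 1 - κ.real univ / n := by
    rw [sub_nonneg, div_le_one hn']
    exact hκ
  have hJ : ∀ (μ : Measure (M × M)) [IsProbabilityMeasure μ],
      Integrable (fun p => jumpCov κ f g p.1 p.2) μ := fun μ _ =>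
    Integrable.of_bound (stronglyMeasurable_jumpCov hf hg).aestronglyMeasurable _
      (ae_of_all _ fun p => abs_jumpCov_le hfA hgB p.1 p.2)
  have hAB : ∀ x y, ‖f x * g y‖ ≤ A * B := fun x y => by
    rw [norm_mul]
    exact mul_le_mul (hfA _) (hgB _) (norm_nonneg _) ((abs_nonneg _).trans (hfA x))
  have hC : ∀ (μ : Measure (M × M)) [IsProbabilityMeasure μ],
      Integrable (fun p => ∫ u, f (p.1 + u) * g (p.2 + u) ∂(lazyStep κ n) -
      (∫ u, f (p.1 + u) ∂(lazyStep κ n)) * ∫ u, g (p.2 + u) ∂(lazyStep κ n)) μ := by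
    intro μ _
    refine Integrable.sub ?_ ?_
    · refine Integrable.of_bound (C := A * B) ?_ (ae_of_all _ fun p => ?_)
      · exact (StronglyMeasurable.integral_prod_right' (f := fun z : (M × M) × M =>
          f (z.1.1 + z.2) * g (z.1.2 + z.2))
          (Measurable.stronglyMeasurable (by fun_prop))).aestronglyMeasurable
      · simpa using norm_integral_le_of_norm_le_const (μ := lazyStep κ n)
          (ae_of_all _ fun u => hAB (p.1 + u) (p.2 + u))
    · refine Integrable.of_bound (C := A * B) ?_ (ae_of_all _ fun p => ?_)
      · exact ((StronglyMeasurable.integral_prod_right' (f := fun z : (M × M) × M =>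
          f (z.1.1 + z.2)) (Measurable.stronglyMeasurable (by fun_prop))).mul
          (StronglyMeasurable.integral_prod_right' (f := fun z : (M × M) × M =>
          g (z.1.2 + z.2)) (Measurable.stronglyMeasurable (by fun_prop)))).aestronglyMeasurable
      · rw [norm_mul]
        have h1 := norm_integral_le_of_norm_le_const (μ := lazyStep κ n)
          (f := fun u => f (p.1 + u)) (ae_of_all _ fun u => hfA (p.1 + u))
        have h2 := norm_integral_le_of_norm_le_const (μ := lazyStep κ n)
          (f := fun u => g (p.2 + u)) (ae_of_all _ fun u => hgB (p.2 + u))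
        simp only [probReal_univ, mul_one] at h1 h2
        exact mul_le_mul h1 h2 (norm_nonneg _) ((norm_nonneg _).trans h1)
  rw [walkLaw_cov_eq_sum _ _ hf hg hfA hgB, meanCoupling, integral_smul_measure,
    integral_finsetSum_measure (fun i _ => hJ _), ENNReal.toReal_ofReal (by positivity),
    smul_eq_mul, Finset.mul_sum, ← Finset.sum_sub_distrib]
  refine (Finset.abs_sum_le_sum_abs _ _).trans ?_
  have key : ∀ i ∈ Finset.range n, |∫ p, (∫ u, f (p.1 + u) * g (p.2 + u) ∂(lazyStep κ n) -
      (∫ u, f (p.1 + u) ∂(lazyStep κ n)) * ∫ u, g (p.2 + u) ∂(lazyStep κ n))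
        ∂(coupledLaw (lazyStep κ n) a i (n - 1 - i)) -
      (1 - κ.real univ / n) / n *
        ∫ p, jumpCov κ f g p.1 p.2 ∂(coupledLaw (lazyStep κ n) a i (n - 1 - i))| ≤
      2 * (κ.real univ / n) ^ 2 * (A * B) := fun i _ => by
    rw [← integral_const_mul, ← integral_sub (hC _) ((hJ _).const_mul _)]
    refine (abs_integral_le_of_abs_le (coupledLaw (lazyStep κ n) a i (n - 1 - i))
      fun p => ?_).trans_eq
        (by rw [probReal_univ, mul_one])
    exact (abs_lazyStep_cov_sub_jumpCov_le hn hκ hf hg hfA hgB p.1 p.2)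
  refine (Finset.sum_le_sum key).trans_eq ?_
  rw [Finset.sum_const, Finset.card_range, nsmul_eq_mul]
  field_simp

end LazyStep

/-! ### Compound Poisson laws as limits of walks -/

lemma norm_pow_sub_pow_le_of_norm_le_one {w v : ℂ} (hw : ‖w‖ ≤ 1) (hv : ‖v‖ ≤ 1) (n : ℕ) :
    ‖w ^ n - v ^ n‖ ≤ n * ‖w - v‖ := by
  induction n with
  | zero => simp
  | succ n ih =>
    have e : w ^ (n + 1) - v ^ (n + 1) = w ^ n * (w - v) + (w ^ n - v ^ n) * v := by ring
    rw [e]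
    have h1 : ‖w ^ n * (w - v)‖ ≤ ‖w - v‖ := by
      rw [norm_mul, norm_pow]
      exact mul_le_of_le_one_left (norm_nonneg _) (pow_le_one₀ (norm_nonneg _) hw)
    have h2 : ‖(w ^ n - v ^ n) * v‖ ≤ n * ‖w - v‖ := by
      rw [norm_mul]
      exact (mul_le_of_le_one_right (norm_nonneg _) hv).trans ih
    refine (norm_add_le _ _).trans ?_
    push_cast
    linarith

/-- Both 1 + z/n and e^{z/n} lie in the closed unit disc, where n-th powers expand distances at most
n times, and they differ by at most |z/n|². -/
lemma norm_one_add_div_pow_sub_exp_le {z : ℂ} {n : ℕ} (hn : 0 < n) (hz : ‖z‖ ≤ n)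
    (hre : z.re ≤ 0) (hw : ‖1 + z / n‖ ≤ 1) : ‖(1 + z / n) ^ n - Complex.exp z‖ ≤ ‖z‖ ^ 2 / n := by
  have hn' : (0 : ℝ) < n := Nat.cast_pos.2 hn
  have hnc : (n : ℂ) ≠ 0 := Nat.cast_ne_zero.2 hn.ne'
  have e : Complex.exp z = Complex.exp (z / n) ^ n := by
    rw [← Complex.exp_nat_mul, mul_div_cancel₀ _ hnc]
  have hv : ‖Complex.exp (z / n)‖ ≤ 1 := by
    rw [Complex.norm_exp, Real.exp_le_one_iff, Complex.div_natCast_re]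
    exact div_nonpos_of_nonpos_of_nonneg hre hn'.le
  have hzn : ‖z / n‖ ≤ 1 := by
    rw [norm_div, Complex.norm_natCast, div_le_one hn']
    exact hz
  have h1 := Complex.norm_exp_sub_one_sub_id_le hzn
  rw [e]
  refine (norm_pow_sub_pow_le_of_norm_le_one hw hv n).trans ?_
  have h2 : ‖(1 + z / n) - Complex.exp (z / n)‖ ≤ (‖z‖ / n) ^ 2 := by
    rw [norm_sub_rev, ← sub_sub]
    refine h1.trans_eq ?_
    rw [norm_div, Complex.norm_natCast]
  calc (n : ℝ) * ‖(1 + z / n) - Complex.exp (z / n)‖ ≤ n * (‖z‖ / n) ^ 2 := by gcongr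
    _ = ‖z‖ ^ 2 / n := by field_simp

section Coupling

variable {E : Type*} [NormedAddCommGroup E] [InnerProductSpace ℝ E] [MeasurableSpace E]
  [BorelSpace E] [SecondCountableTopology E]

lemma charFun_walkLaw (ρ : Measure E) [IsProbabilityMeasure ρ] (a t : E) (n : ℕ) :
    charFun (walkLaw ρ (Measure.dirac a) n) t =
      Complex.exp ((inner ℝ a t : ℝ) * Complex.I) * charFun ρ t ^ n := by
  induction n with
  | zero => simp [walkLaw, charFun_dirac]
  | succ n ih => rw [walkLaw, charFun_conv, ih, pow_succ, mul_assoc]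

/-- The exponent `∫ (e^{i⟨u, t⟩} - 1) κ(du)` of the compound Poisson law with jump measure `κ`. -/
noncomputable def poissonExponent (κ : Measure E) (t : E) : ℂ :=
  ∫ u, (Complex.exp ((inner ℝ u t : ℝ) * Complex.I) - 1) ∂κ

lemma norm_exp_inner_mul_I (u t : E) : ‖Complex.exp ((inner ℝ u t : ℝ) * Complex.I)‖ = 1 :=
  Complex.norm_exp_ofReal_mul_I _

lemma integrable_exp_inner_mul_I (κ : Measure E) [IsFiniteMeasure κ] (t : E) :
    Integrable (fun u => Complex.exp ((inner ℝ u t : ℝ) * Complex.I)) κ :=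
  Integrable.of_bound (Continuous.aestronglyMeasurable (by fun_prop)) 1
    (ae_of_all _ fun u => (norm_exp_inner_mul_I u t).le)

lemma norm_poissonExponent_le (κ : Measure E) [IsFiniteMeasure κ] (t : E) :
    ‖poissonExponent κ t‖ ≤ 2 * κ.real univ := by
  refine norm_integral_le_of_norm_le_const (ae_of_all _ fun u => ?_)
  refine (norm_sub_le _ _).trans ?_
  rw [norm_exp_inner_mul_I, norm_one]
  norm_num

lemma re_poissonExponent_nonpos (κ : Measure E) [IsFiniteMeasure κ] (t : E) :
    (poissonExponent κ t).re ≤ 0 := by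
  have hi : Integrable (fun u => Complex.exp ((inner ℝ u t : ℝ) * Complex.I) - 1) κ :=
    (integrable_exp_inner_mul_I κ t).sub (integrable_const _)
  have : (poissonExponent κ t).re =
      ∫ u, (Complex.exp ((inner ℝ u t : ℝ) * Complex.I) - 1).re ∂κ :=
    (integral_re hi).symm
  rw [this]
  refine integral_nonpos fun u => ?_
  have := Complex.re_le_norm (Complex.exp ((inner ℝ u t : ℝ) * Complex.I))
  rw [norm_exp_inner_mul_I] at this
  simpa using this

lemma charFun_lazyStep (κ : Measure E) [IsFiniteMeasure κ] {n : ℕ} (hn : 0 < n)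
    (hκ : κ.real univ ≤ n) (t : E) :
    charFun (lazyStep κ n) t = 1 + poissonExponent κ t / n := by
  have hn' : (n : ℂ) ≠ 0 := Nat.cast_ne_zero.2 hn.ne'
  have hc : Continuous fun u : E => Complex.exp ((inner ℝ u t : ℝ) * Complex.I) := by fun_prop
  rw [charFun_apply, integral_lazyStep hn hκ hc.stronglyMeasurable
    (fun u => (norm_exp_inner_mul_I u t).le), poissonExponent,
    integral_sub (integrable_exp_inner_mul_I κ t) (integrable_const _), integral_const]
  simp only [inner_zero_left, Complex.ofReal_zero, zero_mul, Complex.exp_zero, Complex.real_smul]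
  generalize (∫ u, Complex.exp ((inner ℝ u t : ℝ) * Complex.I) ∂κ) = w
  push_cast
  field_simp
  ring

theorem exists_coupling (κ : Measure E) [IsFiniteMeasure κ] (a : E) {ε : ℝ} (hε : 0 < ε) :
    ∃ (μ : Measure E) (Q : Measure (E × E)), IsProbabilityMeasure μ ∧
      Q.map Prod.fst ≤ μ ∧ Q.map Prod.snd ≤ μ ∧ 1 - ε ≤ Q.real univ ∧
      (∀ t, ‖charFun μ t -
        Complex.exp ((inner ℝ a t : ℝ) * Complex.I + poissonExponent κ t)‖ ≤ ε) ∧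
      ∀ (f g : E → ℝ) (A B : ℝ), Measurable f → Measurable g → (∀ x, |f x| ≤ A) →
        (∀ x, |g x| ≤ B) →
        |(∫ x, f x * g x ∂μ - (∫ x, f x ∂μ) * ∫ x, g x ∂μ) -
          ∫ p, jumpCov κ f g p.1 p.2 ∂Q| ≤ ε * (A * B) := by
  have h0 : 0 ≤ κ.real univ := measureReal_nonneg
  -- With l the mass of κ, n ≥ 2l gives |z| ≤ n for the Poisson exponent z, since |z| ≤ 2l. The term
  -- (l + 4l²)/ε covers the mass deficit l/n, the characteristic function error (2l)²/n and the
  -- covariance error 2l²/n.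
  obtain ⟨n, hn⟩ := exists_nat_gt ((κ.real univ + 4 * κ.real univ ^ 2) / ε + 2 * κ.real univ)
  have hn0 : (0 : ℝ) < n := lt_of_le_of_lt (by positivity) hn
  have hn1 : 0 < n := Nat.cast_pos.1 hn0
  have hd : 0 ≤ (κ.real univ + 4 * κ.real univ ^ 2) / ε := by positivity
  have hκ2 : 2 * κ.real univ ≤ n := by linarith
  have hκ : κ.real univ ≤ n := by linarith
  have hεn : κ.real univ + 4 * κ.real univ ^ 2 ≤ ε * n := by
    have : (κ.real univ + 4 * κ.real univ ^ 2) / ε ≤ n := by linarith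
    rwa [div_le_iff₀' hε] at this
  have hprob := isProbabilityMeasure_lazyStep hn1 hκ
  refine ⟨walkLaw (lazyStep κ n) (Measure.dirac a) n, meanCoupling κ a n, inferInstance,
    meanCoupling_map_le hn1 hκ a measurable_fst (map_fst_coupledLaw _ _),
    meanCoupling_map_le hn1 hκ a measurable_snd (map_snd_coupledLaw _ _), ?_, fun t => ?_, ?_⟩
  · rw [meanCoupling_real_univ hn1 hκ]
    have : κ.real univ / n ≤ ε := by
      rw [div_le_iff₀ hn0]
      nlinarith [sq_nonneg (κ.real univ)]
    linarith
  · have hz := norm_poissonExponent_le κ t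
    have hw : ‖1 + poissonExponent κ t / n‖ ≤ 1 := by
      rw [← charFun_lazyStep κ hn1 hκ t]
      exact norm_charFun_le_one t
    rw [charFun_walkLaw, charFun_lazyStep κ hn1 hκ, Complex.exp_add, ← mul_sub, norm_mul,
      norm_exp_inner_mul_I, one_mul]
    refine (norm_one_add_div_pow_sub_exp_le hn1 (hz.trans hκ2)
      (re_poissonExponent_nonpos κ t) hw).trans ?_
    rw [div_le_iff₀ hn0]
    nlinarith [norm_nonneg (poissonExponent κ t)]
  · intro f g A B hf hg hfA hgB
    refine (abs_walkLaw_cov_sub_le hn1 hκ a hf hg hfA hgB).trans ?_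
    have hAB : 0 ≤ A * B :=
      mul_nonneg ((abs_nonneg _).trans (hfA 0)) ((abs_nonneg _).trans (hgB 0))
    refine mul_le_mul_of_nonneg_right ?_ hAB
    rw [div_le_iff₀ hn0]
    nlinarith [sq_nonneg (κ.real univ)]

end Coupling

/-! ### Covariance inequalities for limits of compound Poisson laws -/

section CovarianceLimit

variable {E : Type*} [NormedAddCommGroup E] [InnerProductSpace ℝ E] [FiniteDimensional ℝ E]
  [MeasurableSpace E] [BorelSpace E] {κ : ℕ → Measure E} [∀ m, IsFiniteMeasure (κ m)] {a : ℕ → E}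
  {μ : Measure E} [hμ : IsProbabilityMeasure μ]

theorem exists_coupling_seq (h : ∀ t, Tendsto (fun m =>
      Complex.exp ((inner ℝ (a m) t : ℝ) * Complex.I + poissonExponent (κ m) t)) atTop
      (𝓝 (charFun μ t))) :
    ∃ (μs : ℕ → ProbabilityMeasure E) (Q : ℕ → Measure (E × E)),
      Tendsto μs atTop (𝓝 ⟨μ, hμ⟩) ∧
      (∀ m, (Q m).map Prod.fst ≤ (μs m : Measure E)) ∧
      (∀ m, (Q m).map Prod.snd ≤ (μs m : Measure E)) ∧
      (∀ m : ℕ, 1 - 1 / ((m : ℝ) + 1) ≤ (Q m).real univ) ∧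
      ∀ (f g : E → ℝ) (A B : ℝ), Measurable f → Measurable g → (∀ x, |f x| ≤ A) →
        (∀ x, |g x| ≤ B) → ∀ m : ℕ,
        |(∫ x, f x * g x ∂(μs m : Measure E) - (∫ x, f x ∂(μs m : Measure E)) *
          ∫ x, g x ∂(μs m : Measure E)) - ∫ p, jumpCov (κ m) f g p.1 p.2 ∂(Q m)| ≤
          1 / ((m : ℝ) + 1) * (A * B) := by
  have := FiniteDimensional.proper_real E
  have hε : ∀ m : ℕ, 0 < 1 / ((m : ℝ) + 1) := fun m => Nat.one_div_pos_of_nat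
  choose μs Q h1 h2 h3 h4 h5 h6 using fun m => exists_coupling (κ m) (a m) (hε m)
  refine ⟨fun m => ⟨μs m, h1 m⟩, Q, ?_, h2, h3, h4, fun f g A B hf hg hA hB m =>
    h6 m f g A B hf hg hA hB⟩
  refine ProbabilityMeasure.tendsto_of_tendsto_charFun fun t => ?_
  have : Tendsto (fun m => charFun (μs m) t -
      Complex.exp ((inner ℝ (a m) t : ℝ) * Complex.I + poissonExponent (κ m) t)) atTop (𝓝 0) :=
    squeeze_zero_norm (fun m => h5 m t) tendsto_one_div_add_atTop_nhds_zero_nat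
  simpa using this.add (h t)

lemma tendsto_integral_of_abs_le {μs : ℕ → ProbabilityMeasure E} {ν : ProbabilityMeasure E}
    (h : Tendsto μs atTop (𝓝 ν)) {f : E → ℝ} (hf : Continuous f) {A : ℝ} (hA : ∀ x, |f x| ≤ A) :
    Tendsto (fun m => ∫ x, f x ∂(μs m : Measure E)) atTop (𝓝 (∫ x, f x ∂(ν : Measure E))) :=
  ProbabilityMeasure.tendsto_iff_forall_integral_tendsto.1 h
    (BoundedContinuousFunction.ofNormedAddCommGroup f hf A hA)

lemma tendsto_cov_of_abs_le {μs : ℕ → ProbabilityMeasure E} {ν : ProbabilityMeasure E}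
    (h : Tendsto μs atTop (𝓝 ν)) {f g : E → ℝ} (hf : Continuous f) (hg : Continuous g) {A B : ℝ}
    (hA : ∀ x, |f x| ≤ A) (hB : ∀ x, |g x| ≤ B) :
    Tendsto (fun m => ∫ x, f x * g x ∂(μs m : Measure E) - (∫ x, f x ∂(μs m : Measure E)) *
          ∫ x, g x ∂(μs m : Measure E)) atTop
      (𝓝 (∫ x, f x * g x ∂(ν : Measure E) - (∫ x, f x ∂(ν : Measure E)) *
          ∫ x, g x ∂(ν : Measure E))) := by
  have hfg : ∀ x, |f x * g x| ≤ A * B := fun x => by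
    rw [abs_mul]
    exact mul_le_mul (hA x) (hB x) (abs_nonneg _) ((abs_nonneg _).trans (hA x))
  exact (tendsto_integral_of_abs_le h (hf.mul hg) hfg).sub
    ((tendsto_integral_of_abs_le h hf hA).mul (tendsto_integral_of_abs_le h hg hB))

/-- The bound on the jump covariance involves only the second position, whose law under the coupling
is dominated by the law of the walk. Nonnegativity of g and C then allows passing to the latter, and
weak convergence does the rest. -/
theorem cov_le_of_jumpCov_le (h : ∀ t, Tendsto (fun m =>
      Complex.exp ((inner ℝ (a m) t : ℝ) * Complex.I + poissonExponent (κ m) t)) atTop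
      (𝓝 (charFun μ t))) {f g : E → ℝ} (hf : Continuous f) (hg : Continuous g) {A B C : ℝ}
    (hA : ∀ x, |f x| ≤ A) (hB : ∀ x, |g x| ≤ B) (hC : 0 ≤ C) (hg0 : ∀ x, 0 ≤ g x)
    (hJ : ∀ m x y, jumpCov (κ m) f g x y ≤ C * g y) :
    ∫ x, f x * g x ∂μ - (∫ x, f x ∂μ) * ∫ x, g x ∂μ ≤ C * ∫ x, g x ∂μ := by
  obtain ⟨μs, Q, h1, h2, h3, h4, h5⟩ := exists_coupling_seq h
  have t1 := tendsto_cov_of_abs_le h1 hf hg hA hB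
  have t2 : Tendsto (fun m : ℕ => C * ∫ x, g x ∂(μs m : Measure E) + 1 / ((m : ℝ) + 1) * (A * B))
      atTop (𝓝 (C * ∫ x, g x ∂μ + 0 * (A * B))) :=
    ((tendsto_integral_of_abs_le h1 hg hB).const_mul C).add
      (tendsto_one_div_add_atTop_nhds_zero_nat.mul_const _)
  rw [zero_mul, add_zero] at t2
  refine le_of_tendsto_of_tendsto' t1 t2 fun m => ?_
  have hQ : IsFiniteMeasure (Q m) := by
    have : IsFiniteMeasure ((Q m).map Prod.snd) := isFiniteMeasure_of_le _ (h3 m)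
    refine ⟨?_⟩
    have := measure_lt_top ((Q m).map Prod.snd) univ
    rwa [Measure.map_apply measurable_snd MeasurableSet.univ, preimage_univ] at this
  have hgi : Integrable g (μs m : Measure E) :=
    Integrable.of_bound hg.aestronglyMeasurable B (ae_of_all _ hB)
  have e1 : ∫ p, jumpCov (κ m) f g p.1 p.2 ∂(Q m) ≤ C * ∫ x, g x ∂(μs m : Measure E) := by
    have hi2 : Integrable (fun p : E × E => C * g p.2) (Q m) :=
      (Integrable.of_bound (hg.comp continuous_snd).aestronglyMeasurable B
        (ae_of_all _ fun p => hB p.2)).const_mul _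
    calc ∫ p, jumpCov (κ m) f g p.1 p.2 ∂(Q m) ≤ ∫ p, C * g p.2 ∂(Q m) := by
          refine integral_mono ?_ hi2 fun p => hJ m p.1 p.2
          exact Integrable.of_bound (stronglyMeasurable_jumpCov hf.measurable
            hg.measurable).aestronglyMeasurable _
              (ae_of_all _ fun p => abs_jumpCov_le hA hB p.1 p.2)
      _ = C * ∫ x, g x ∂((Q m).map Prod.snd) := by
          rw [integral_const_mul, integral_map measurable_snd.aemeasurable
            hg.aestronglyMeasurable]
      _ ≤ C * ∫ x, g x ∂(μs m : Measure E) :=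
          mul_le_mul_of_nonneg_left (integral_mono_measure (h3 m) (ae_of_all _ hg0) hgi) hC
  have := (abs_le.1 (h5 f g A B hf.measurable hg.measurable hA hB m)).2
  linarith

/-- In the limit the coupling has mass close to 1, and each position leaves the ball of radius R
with mass less than 1/8. Both are therefore inside with mass close to at least 3/4, and the jump
covariance is nonnegative elsewhere. The constant 1/2 leaves slack. -/
theorem half_le_cov_of_le_jumpCov (h : ∀ t, Tendsto (fun m =>
      Complex.exp ((inner ℝ (a m) t : ℝ) * Complex.I + poissonExponent (κ m) t)) atTop
      (𝓝 (charFun μ t))) {f g : E → ℝ} (hf : Continuous f) (hg : Continuous g) {A B C R : ℝ}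
    (hA : ∀ x, |f x| ≤ A) (hB : ∀ x, |g x| ≤ B) (hC : 0 ≤ C)
    (hR : μ {x | R ≤ ‖x‖} < ENNReal.ofReal (1 / 8)) (hJ0 : ∀ m x y, 0 ≤ jumpCov (κ m) f g x y)
    (hJ : ∀ᶠ m in atTop, ∀ x y, ‖x‖ ≤ R → ‖y‖ ≤ R → C ≤ jumpCov (κ m) f g x y) :
    C / 2 ≤ ∫ x, f x * g x ∂μ - (∫ x, f x ∂μ) * ∫ x, g x ∂μ := by
  obtain ⟨μs, Q, h1, h2, h3, h4, h5⟩ := exists_coupling_seq h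
  have t1 := tendsto_cov_of_abs_le h1 hf hg hA hB
  have t2 : Tendsto (fun m : ℕ => C * (1 - 1 / ((m : ℝ) + 1) - 1 / 4) -
      1 / ((m : ℝ) + 1) * (A * B)) atTop (𝓝 (C * (1 - 0 - 1 / 4) - 0 * (A * B))) :=
    (((tendsto_const_nhds.sub tendsto_one_div_add_atTop_nhds_zero_nat).sub
      tendsto_const_nhds).const_mul C).sub (tendsto_one_div_add_atTop_nhds_zero_nat.mul_const _)
  have hcl : IsClosed {x : E | R ≤ ‖x‖} := isClosed_le continuous_const continuous_norm
  have hls := ProbabilityMeasure.limsup_measure_closed_le_of_tendsto h1 hcl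
  -- Portmanteau for a closed set: the small mass of the complement of the open ball passes from the
  -- limit to the approximations.
  have hev : ∀ᶠ m in atTop, (μs m : Measure E) {x | R ≤ ‖x‖} < ENNReal.ofReal (1 / 8) :=
    eventually_lt_of_limsup_lt (lt_of_le_of_lt hls hR)
  refine le_trans ?_ (le_of_tendsto_of_tendsto t2 t1 ?_)
  · linarith
  filter_upwards [hJ, hev] with m hm hevm
  have hQ : IsFiniteMeasure (Q m) := by
    have : IsFiniteMeasure ((Q m).map Prod.snd) := isFiniteMeasure_of_le _ (h3 m)
    refine ⟨?_⟩
    have := measure_lt_top ((Q m).map Prod.snd) univ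
    rwa [Measure.map_apply measurable_snd MeasurableSet.univ, preimage_univ] at this
  set s : Set (E × E) := {p | ‖p.1‖ < R} ∩ {p | ‖p.2‖ < R} with hs
  have hsm : MeasurableSet s :=
    (measurableSet_lt measurable_fst.norm measurable_const).inter
      (measurableSet_lt measurable_snd.norm measurable_const)
  have hsc : (Q m).real sᶜ ≤ 1 / 4 := by
    have b1 : (Q m) {p | R ≤ ‖p.1‖} ≤ ENNReal.ofReal (1 / 8) := by
      have := h2 m {x | R ≤ ‖x‖}
      rw [Measure.map_apply measurable_fst hcl.measurableSet] at this
      exact this.trans hevm.le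
    have b2 : (Q m) {p | R ≤ ‖p.2‖} ≤ ENNReal.ofReal (1 / 8) := by
      have := h3 m {x | R ≤ ‖x‖}
      rw [Measure.map_apply measurable_snd hcl.measurableSet] at this
      exact this.trans hevm.le
    have b3 : (Q m) sᶜ ≤ ENNReal.ofReal (1 / 4) := by
      have hsub : sᶜ ⊆ {p : E × E | R ≤ ‖p.1‖} ∪ {p | R ≤ ‖p.2‖} := by
        intro p hp
        by_contra hcon
        simp only [mem_union, mem_ofPred_eq, not_or, not_le] at hcon
        exact hp hcon
      calc (Q m) sᶜ ≤ _ := measure_mono hsub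
        _ ≤ _ := measure_union_le _ _
        _ ≤ ENNReal.ofReal (1 / 8) + ENNReal.ofReal (1 / 8) := add_le_add b1 b2
        _ = ENNReal.ofReal (1 / 4) := by
          rw [← ENNReal.ofReal_add (by norm_num) (by norm_num)]
          norm_num
    exact ENNReal.toReal_le_of_le_ofReal (by norm_num) b3
  have hmass : 1 - 1 / ((m : ℝ) + 1) - 1 / 4 ≤ (Q m).real s := by
    have := h4 m
    have e := measureReal_add_measureReal_compl (μ := Q m) hsm
    linarith
  have e1 : C * (Q m).real s ≤ ∫ p, jumpCov (κ m) f g p.1 p.2 ∂(Q m) := by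
    have : C * (Q m).real s = ∫ p, s.indicator (fun _ => C) p ∂(Q m) := by
      rw [integral_indicator_const _ hsm, smul_eq_mul, mul_comm]
    rw [this]
    refine integral_mono ((integrable_const C).indicator hsm)
      (Integrable.of_bound (stronglyMeasurable_jumpCov hf.measurable
            hg.measurable).aestronglyMeasurable _
              (ae_of_all _ fun p => abs_jumpCov_le hA hB p.1 p.2)) fun p => ?_
    by_cases hp : p ∈ s
    · rw [indicator_of_mem hp]
      exact hm _ _ hp.1.le hp.2.le
    · rw [indicator_of_notMem hp]
      exact hJ0 _ _ _
  have := (abs_le.1 (h5 f g A B hf.measurable hg.measurable hA hB m)).1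
  have := mul_le_mul_of_nonneg_left hmass hC
  linarith

end CovarianceLimit

/-! ### The law of X as a limit of compound Poisson laws jumping along the axes -/

lemma norm_exp_mul_I_sub_one_le (x : ℝ) : ‖Complex.exp (Complex.I * x) - 1‖ ≤ 2 := by
  refine (norm_sub_le _ _).trans ?_
  rw [mul_comm, Complex.norm_exp_ofReal_mul_I, norm_one]
  norm_num

lemma norm_exp_mul_I_sub_one_sub_le (x : ℝ) :
    ‖Complex.exp (Complex.I * x) - 1 - Complex.I * x‖ ≤ 3 * x ^ 2 := by
  have hx : ‖Complex.I * (x : ℂ)‖ = |x| := by simp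
  rcases le_total |x| 1 with h | h
  · refine (Complex.norm_exp_sub_one_sub_id_le (by rwa [hx])).trans ?_
    rw [hx, sq_abs]
    nlinarith [sq_nonneg x]
  · refine (norm_sub_le _ _).trans ?_
    rw [hx]
    have := norm_exp_mul_I_sub_one_le x
    nlinarith [sq_abs x]

section AxisLevyMeasure

variable {d : ℕ} {ν : Measure (EuclideanSpace ℝ (Fin d))}

/-- The restriction to `{|u_k| > r}` of the measure with independent coordinates
`∑_k δ₀ ⊗ ⋯ ⊗ ν̃_k ⊗ ⋯ ⊗ δ₀`. -/
noncomputable def axisMeasure (ν : Measure (EuclideanSpace ℝ (Fin d))) (r : ℝ) :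
    Measure (EuclideanSpace ℝ (Fin d)) :=
  ∑ k, (ν.restrict {u | r < |u k|}).map fun u => EuclideanSpace.single k (u k)

lemma measurableSet_lt_abs_coord (r : ℝ) (k : Fin d) :
    MeasurableSet {u : EuclideanSpace ℝ (Fin d) | r < |u k|} :=
  (isOpen_lt continuous_const (by fun_prop)).measurableSet

lemma measurable_single_coord (k : Fin d) : Measurable
    fun u : EuclideanSpace ℝ (Fin d) => (EuclideanSpace.single k (u k) :
      EuclideanSpace ℝ (Fin d)) := by
  have : (fun u : EuclideanSpace ℝ (Fin d) => (EuclideanSpace.single k (u k) :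
      EuclideanSpace ℝ (Fin d))) = fun u => u k • EuclideanSpace.single k (1 : ℝ) := by
    ext u i
    simp
  rw [this]
  exact Continuous.measurable (by fun_prop)

lemma IsLevyMeasure.integrable_of_norm_le (hν : IsLevyMeasure ν)
    {F : Type*} [NormedAddCommGroup F] {φ : EuclideanSpace ℝ (Fin d) → F}
    (hφ : AEStronglyMeasurable φ ν) {C : ℝ} (h : ∀ u, ‖φ u‖ ≤ C * min 1 (‖u‖ ^ 2)) :
    Integrable φ ν := by
  have hm : Measurable fun u : EuclideanSpace ℝ (Fin d) => min 1 (‖u‖ ^ 2) := by fun_prop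
  have h1 : Integrable (fun u : EuclideanSpace ℝ (Fin d) => min 1 (‖u‖ ^ 2)) ν := by
    refine ⟨hm.aestronglyMeasurable, ?_⟩
    rw [hasFiniteIntegral_iff_ofReal (ae_of_all _ fun u => by positivity)]
    exact hν.lintegral_lt_top
  exact (h1.const_mul C).mono' hφ (ae_of_all _ h)

lemma IsLevyMeasure.measure_lt_abs_coord_lt_top (hν : IsLevyMeasure ν) {r : ℝ} (hr : 0 < r)
    (k : Fin d) : ν {u | r < |u k|} < ∞ := by
  have h0 : 0 < min 1 (r ^ 2) := by positivity
  have hsub : {u : EuclideanSpace ℝ (Fin d) | r < |u k|} ⊆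
      {u | ENNReal.ofReal (min 1 (r ^ 2)) ≤ ENNReal.ofReal (min 1 (‖u‖ ^ 2))} := by
    intro u hu
    have h1 : |u k| ≤ ‖u‖ := PiLp.norm_apply_le u k
    have h2 : r < |u k| := hu
    exact ENNReal.ofReal_le_ofReal (min_le_min_left _ (by gcongr; linarith))
  refine lt_of_le_of_lt (measure_mono hsub) ?_
  refine lt_of_le_of_lt (meas_ge_le_lintegral_div
    (Measurable.aemeasurable (by fun_prop)) (ENNReal.ofReal_pos.2 h0).ne' ENNReal.ofReal_ne_top) ?_
  exact ENNReal.div_lt_top hν.lintegral_lt_top.ne (ENNReal.ofReal_pos.2 h0).ne'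

lemma IsLevyMeasure.isFiniteMeasure_restrict (hν : IsLevyMeasure ν) {r : ℝ} (hr : 0 < r)
    (k : Fin d) : IsFiniteMeasure (ν.restrict {u | r < |u k|}) :=
  ⟨by simpa using hν.measure_lt_abs_coord_lt_top hr k⟩

lemma IsLevyMeasure.isFiniteMeasure_axisMeasure (hν : IsLevyMeasure ν) {r : ℝ} (hr : 0 < r) :
    IsFiniteMeasure (axisMeasure ν r) := by
  have := fun k => hν.isFiniteMeasure_restrict hr k
  unfold axisMeasure
  infer_instance

lemma IsLevyMeasure.integral_axisMeasure (hν : IsLevyMeasure ν) {r : ℝ} (hr : 0 < r)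
    {F : Type*} [NormedAddCommGroup F] [NormedSpace ℝ F] {φ : EuclideanSpace ℝ (Fin d) → F}
    (hφ : StronglyMeasurable φ) {C : ℝ} (hC : ∀ u, ‖φ u‖ ≤ C) :
    ∫ u, φ u ∂(axisMeasure ν r) =
      ∑ k, ∫ u in {u | r < |u k|}, φ (EuclideanSpace.single k (u k)) ∂ν := by
  have := fun k => hν.isFiniteMeasure_restrict hr k
  rw [axisMeasure, integral_finsetSum_measure fun k _ =>
    Integrable.of_bound hφ.aestronglyMeasurable C (ae_of_all _ hC)]
  exact Finset.sum_congr rfl fun k _ => integral_map (measurable_single_coord k).aemeasurable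
    hφ.aestronglyMeasurable

/-- The integrand of the Lévy–Khintchine exponent in the direction `s e_k`. -/
noncomputable def coordIntegrand (k : Fin d) (s : ℝ) (u : EuclideanSpace ℝ (Fin d)) : ℂ :=
  Complex.exp (Complex.I * ((s * u k : ℝ) : ℂ)) - 1 -
    {v : EuclideanSpace ℝ (Fin d) | ‖v‖ ≤ 1}.indicator
      (fun v => Complex.I * ((s * v k : ℝ) : ℂ)) u

lemma measurableSet_norm_le_one :
    MeasurableSet {v : EuclideanSpace ℝ (Fin d) | ‖v‖ ≤ 1} :=
  (isClosed_le continuous_norm continuous_const).measurableSet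

lemma measurable_coordIntegrand (k : Fin d) (s : ℝ) : Measurable (coordIntegrand k s) := by
  unfold coordIntegrand
  refine Measurable.sub ?_ (Measurable.indicator ?_ measurableSet_norm_le_one)
  · exact Continuous.measurable (by fun_prop)
  · exact Continuous.measurable (by fun_prop)

lemma IsLevyMeasure.integrable_coordIntegrand (hν : IsLevyMeasure ν) (k : Fin d) (s : ℝ) :
    Integrable (coordIntegrand k s) ν := by
  refine hν.integrable_of_norm_le (C := 2 + 3 * s ^ 2)
    (measurable_coordIntegrand k s).aestronglyMeasurable fun u => ?_
  have h1 : |u k| ≤ ‖u‖ := PiLp.norm_apply_le u k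
  by_cases hu : ‖u‖ ≤ 1
  · rw [coordIntegrand, indicator_of_mem (by exact hu),
      min_eq_right (pow_le_one₀ (norm_nonneg u) hu)]
    refine (norm_exp_mul_I_sub_one_sub_le (s * u k)).trans ?_
    have : u k ^ 2 ≤ ‖u‖ ^ 2 := sq_le_sq' (by linarith [neg_abs_le (u k)]) (by
      linarith [le_abs_self (u k)])
    nlinarith [sq_nonneg s, sq_nonneg ‖u‖, mul_le_mul_of_nonneg_left this (sq_nonneg s)]
  · rw [coordIntegrand, indicator_of_notMem (by exact hu), sub_zero,
      min_eq_left (one_le_pow₀ (not_le.1 hu).le)]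
    refine (norm_exp_mul_I_sub_one_le (s * u k)).trans ?_
    nlinarith [sq_nonneg s]

/-- The drift compensating the jumps of `axisMeasure ν r`. -/
noncomputable def axisDrift (γ : EuclideanSpace ℝ (Fin d))
    (ν : Measure (EuclideanSpace ℝ (Fin d))) (r : ℝ) : EuclideanSpace ℝ (Fin d) :=
  WithLp.toLp 2 fun k => γ k - ∫ u in {u | r < |u k|},
    {v : EuclideanSpace ℝ (Fin d) | ‖v‖ ≤ 1}.indicator (fun v => v k) u ∂ν

lemma levyExponent_single (γ : EuclideanSpace ℝ (Fin d)) (k : Fin d) (s : ℝ) :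
    levyExponent γ ν (EuclideanSpace.single k s) =
      Complex.I * ((s * γ k : ℝ) : ℂ) + ∫ u, coordIntegrand k s u ∂ν := by
  simp only [levyExponent, coordIntegrand, EuclideanSpace.inner_single_left, conj_trivial]

/-- The drift subtracts exactly the compensator of the retained jumps. The cutoff ‖u‖ ≤ 1 still
involves the whole vector u under ν, so that each summand is a truncated exponent of ν at t_k e_k
and ν need not be known to live on the axes. -/
lemma IsLevyMeasure.axis_exponent_eq (hν : IsLevyMeasure ν) (γ : EuclideanSpace ℝ (Fin d))
    {r : ℝ} (hr : 0 < r) (t : EuclideanSpace ℝ (Fin d)) :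
    (inner ℝ (axisDrift γ ν r) t : ℝ) * Complex.I + poissonExponent (axisMeasure ν r) t =
      ∑ k, (Complex.I * ((t k * γ k : ℝ) : ℂ) +
        ∫ u in {u | r < |u k|}, coordIntegrand k (t k) u ∂ν) := by
  have hfin := fun k => hν.isFiniteMeasure_restrict hr k
  have hc : Continuous fun u : EuclideanSpace ℝ (Fin d) =>
      Complex.exp ((inner ℝ u t : ℝ) * Complex.I) - 1 := by fun_prop
  rw [poissonExponent, hν.integral_axisMeasure hr hc.stronglyMeasurable (C := 2) fun u => by
    rw [mul_comm]; exact norm_exp_mul_I_sub_one_le _]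
  rw [PiLp.inner_apply, Complex.ofReal_sum, Finset.sum_mul, ← Finset.sum_add_distrib]
  refine Finset.sum_congr rfl fun k _ => ?_
  have i1 : Integrable (fun u : EuclideanSpace ℝ (Fin d) =>
      Complex.exp (Complex.I * ((t k * u k : ℝ) : ℂ)) - 1) (ν.restrict {u | r < |u k|}) :=
    Integrable.of_bound (Continuous.aestronglyMeasurable (by fun_prop)) 2
      (ae_of_all _ fun u => norm_exp_mul_I_sub_one_le _)
  have i2 : Integrable ({v : EuclideanSpace ℝ (Fin d) | ‖v‖ ≤ 1}.indicator fun v => v k)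
      (ν.restrict {u | r < |u k|}) := by
    refine Integrable.of_bound (Measurable.aestronglyMeasurable
      (Measurable.indicator (Continuous.measurable (by fun_prop)) measurableSet_norm_le_one)) 1
      (ae_of_all _ fun u => ?_)
    by_cases hu : ‖u‖ ≤ 1
    · rw [indicator_of_mem (by exact hu)]
      exact (PiLp.norm_apply_le u k).trans hu
    · rw [indicator_of_notMem (by exact hu), norm_zero]
      exact zero_le_one
  have e1 : ∀ u, coordIntegrand k (t k) u = (Complex.exp (Complex.I * ((t k * u k : ℝ) : ℂ)) - 1) -
      (Complex.I * t k) * (({v : EuclideanSpace ℝ (Fin d) | ‖v‖ ≤ 1}.indicator (fun v => v k) u : ℝ)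
        : ℂ) := by
    intro u
    rw [coordIntegrand]
    by_cases hu : ‖u‖ ≤ 1
    · rw [indicator_of_mem (by exact hu), indicator_of_mem (by exact hu)]
      push_cast
      ring
    · rw [indicator_of_notMem (by exact hu), indicator_of_notMem (by exact hu)]
      push_cast
      ring
  simp_rw [e1]
  have i3 : Integrable (fun u => (Complex.I * t k) *
      (({v : EuclideanSpace ℝ (Fin d) | ‖v‖ ≤ 1}.indicator (fun v => v k) u : ℝ) : ℂ))
      (ν.restrict {u | r < |u k|}) := i2.ofReal.const_mul _
  rw [integral_sub i1 i3, integral_const_mul, integral_complex_ofReal]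
  have e2 : ∀ u : EuclideanSpace ℝ (Fin d),
      Complex.exp ((inner ℝ (EuclideanSpace.single k (u k)) t : ℝ) * Complex.I) - 1 =
      Complex.exp (Complex.I * ((t k * u k : ℝ) : ℂ)) - 1 := fun u => by
    rw [EuclideanSpace.inner_single_left, conj_trivial, mul_comm, mul_comm (u k)]
  simp_rw [e2]
  simp only [axisDrift, RCLike.inner_apply, conj_trivial]
  push_cast
  ring

lemma IsLevyMeasure.tendsto_axis_exponent (hν : IsLevyMeasure ν) (γ : EuclideanSpace ℝ (Fin d))
    (t : EuclideanSpace ℝ (Fin d)) :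
    Tendsto (fun m : ℕ => (inner ℝ (axisDrift γ ν (1 / ((m : ℝ) + 1))) t : ℝ) * Complex.I +
        poissonExponent (axisMeasure ν (1 / ((m : ℝ) + 1))) t) atTop
      (𝓝 (∑ k, levyExponent γ ν (EuclideanSpace.single k (t k)))) := by
  have e : ∀ m : ℕ, (inner ℝ (axisDrift γ ν (1 / ((m : ℝ) + 1))) t : ℝ) * Complex.I +
      poissonExponent (axisMeasure ν (1 / ((m : ℝ) + 1))) t = _ := fun m =>
    hν.axis_exponent_eq γ Nat.one_div_pos_of_nat t
  simp_rw [e, levyExponent_single]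
  refine tendsto_finsetSum _ fun k _ => tendsto_const_nhds.add ?_
  simp_rw [← integral_indicator (measurableSet_lt_abs_coord _ k)]
  refine tendsto_integral_of_dominated_convergence (fun u => ‖coordIntegrand k (t k) u‖)
    (fun m => ((measurable_coordIntegrand k (t k)).indicator
      (measurableSet_lt_abs_coord _ k)).aestronglyMeasurable)
    (hν.integrable_coordIntegrand k (t k)).norm
    (fun m => ae_of_all _ fun u => norm_indicator_le_norm_self _ _) (ae_of_all _ fun u => ?_)
  -- Jumps with u_k = 0 are never retained, but the integrand vanishes there.
  rcases eq_or_ne (u k) 0 with h0 | h0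
  · have : coordIntegrand k (t k) u = 0 := by
      by_cases hu : ‖u‖ ≤ 1
      · rw [coordIntegrand, indicator_of_mem (by exact hu), h0]
        simp
      · rw [coordIntegrand, indicator_of_notMem (by exact hu), h0]
        simp
    rw [this]
    refine tendsto_const_nhds.congr fun m => ?_
    by_cases hm : u ∈ {u : EuclideanSpace ℝ (Fin d) | 1 / ((m : ℝ) + 1) < |u k|}
    · rw [indicator_of_mem hm, this]
    · rw [indicator_of_notMem hm]
  · refine tendsto_const_nhds.congr' ?_
    have := tendsto_one_div_add_atTop_nhds_zero_nat (𝕜 := ℝ)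
    filter_upwards [this.eventually_lt_const (abs_pos.2 h0)] with m hm
    rw [indicator_of_mem (by exact hm)]

variable {Ω : Type*} [MeasurableSpace Ω] {P : Measure Ω} [IsProbabilityMeasure P]
  {X : Ω → EuclideanSpace ℝ (Fin d)} {γ : EuclideanSpace ℝ (Fin d)}

/-- This is the step in which independence acts: the characteristic function splits into those of
the coordinates, that is, values of the joint one at t_k e_k. It replaces a proof that ν is carried
by the axes. -/
lemma IsIDVector.charFun_map_eq (hX : IsIDVector P X γ ν)
    (hindep : iIndepFun (fun (k : Fin d) (ω : Ω) => X ω k) P) (t : EuclideanSpace ℝ (Fin d)) :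
    charFun (P.map X) t =
      Complex.exp (∑ k, levyExponent γ ν (EuclideanSpace.single k (t k))) := by
  have hm := hX.aemeasurable
  have hmk : ∀ k, AEMeasurable (fun ω => X ω k) P := fun k =>
    (Continuous.measurable (by fun_prop :
      Continuous fun x : EuclideanSpace ℝ (Fin d) => x k)).comp_aemeasurable hm
  have h1 := (iIndepFun_iff_charFun_pi hmk).1 hindep t
  have h2 : (fun ω => WithLp.toLp 2 fun k => X ω k) = X := rfl
  rw [h2] at h1
  rw [h1, Complex.exp_sum]
  refine Finset.prod_congr rfl fun k _ => ?_
  rw [← hX.charFun_eq, charFun_apply, integral_map (hmk k)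
    (Continuous.aestronglyMeasurable (by fun_prop))]
  refine integral_congr_ae (ae_of_all _ fun ω => ?_)
  simp only [EuclideanSpace.inner_single_left, conj_trivial, RCLike.inner_apply]
  rw [mul_comm]

theorem IsIDVector.tendsto_charFun (hX : IsIDVector P X γ ν)
    (hindep : iIndepFun (fun (k : Fin d) (ω : Ω) => X ω k) P) (t : EuclideanSpace ℝ (Fin d)) :
    Tendsto (fun m : ℕ => Complex.exp
        ((inner ℝ (axisDrift γ ν (1 / ((m : ℝ) + 1))) t : ℝ) * Complex.I +
        poissonExponent (axisMeasure ν (1 / ((m : ℝ) + 1))) t)) atTop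
      (𝓝 (charFun (P.map X) t)) := by
  rw [hX.charFun_map_eq hindep]
  exact (Complex.continuous_exp.tendsto _).comp (hX.isLevyMeasure.tendsto_axis_exponent γ t)

end AxisLevyMeasure

/-! ### Exponential moments of the large jumps -/

lemma exists_measure_norm_ge_lt {E : Type*} [NormedAddCommGroup E] [CompleteSpace E]
    [SecondCountableTopology E] [MeasurableSpace E] [BorelSpace E]
    (μ : Measure E) [IsFiniteMeasure μ] {ε : ℝ≥0∞} (hε : 0 < ε) :
    ∃ R : ℝ, 1 ≤ R ∧ μ {x | R ≤ ‖x‖} < ε := by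
  obtain ⟨δ, hδ0, hδ⟩ := exists_between hε
  obtain ⟨K, hK, hKμ⟩ := isTightMeasureSet_iff_exists_isCompact_measure_compl_le.1
    (isTightMeasureSet_singleton (μ := μ)) δ hδ0
  obtain ⟨r, hr⟩ := hK.isBounded.exists_norm_le
  have hsub : {x : E | max 1 (r + 1) ≤ ‖x‖} ⊆ Kᶜ := fun x hx hxK => by
    have h1 : max 1 (r + 1) ≤ ‖x‖ := hx
    have h2 := hr x hxK
    linarith [le_max_right 1 (r + 1)]
  exact ⟨max 1 (r + 1), le_max_left _ _, ((measure_mono hsub).trans (hKμ μ rfl)).trans_lt hδ⟩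

lemma Monotone.mul_increments_nonneg {F G : ℝ → ℝ} (hF : Monotone F) (hG : Monotone G)
    (a b w : ℝ) : 0 ≤ (F (a + w) - F a) * (G (b + w) - G b) := by
  rcases le_total 0 w with h | h
  · exact mul_nonneg (sub_nonneg.2 (hF (by linarith))) (sub_nonneg.2 (hG (by linarith)))
  · exact mul_nonneg_of_nonpos_of_nonpos (sub_nonpos.2 (hF (by linarith)))
      (sub_nonpos.2 (hG (by linarith)))

section ExponentialMoment

variable {d : ℕ} {ν : Measure (EuclideanSpace ℝ (Fin d))}

lemma measurableSet_lt_mul_coord (r σ : ℝ) (k : Fin d) :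
    MeasurableSet {u : EuclideanSpace ℝ (Fin d) | r < σ * u k} :=
  (isOpen_lt continuous_const (by fun_prop)).measurableSet

lemma lt_mul_coord_subset {σ : ℝ} (hσ : |σ| = 1) {r s : ℝ} (hrs : r ≤ s) (k : Fin d) :
    {u : EuclideanSpace ℝ (Fin d) | s < σ * u k} ⊆ {u | r < |u k|} := fun u hu => by
  have h1 : s < σ * u k := hu
  have h2 := le_abs_self (σ * u k)
  rw [abs_mul, hσ, one_mul] at h2
  exact lt_of_le_of_lt hrs (h1.trans_le h2)

/-- The function equal to `a` on `[-R, R + 1]` and constant on both sides. -/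
noncomputable def clip (R a : ℝ) : ℝ := max (-R) (min (R + 1) a)

/-- The exponential truncated at height `K`. -/
noncomputable def truncExp (c K a : ℝ) : ℝ := min (Real.exp (c * a)) K

lemma clip_monotone (R : ℝ) : Monotone (clip R) := fun _ _ h =>
  max_le_max le_rfl (min_le_min le_rfl h)

lemma truncExp_monotone {c : ℝ} (hc : 0 ≤ c) (K : ℝ) : Monotone (truncExp c K) := fun _ _ h =>
  min_le_min (Real.exp_le_exp.2 (mul_le_mul_of_nonneg_left h hc)) le_rfl

lemma abs_clip_le {R : ℝ} (hR : 0 ≤ R) (a : ℝ) : |clip R a| ≤ R + 1 := by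
  rw [abs_le, clip]
  exact ⟨le_trans (by linarith) (le_max_left _ _), max_le (by linarith) (min_le_left _ _)⟩

lemma one_le_clip_sub {R a w : ℝ} (ha : |a| ≤ R) (hw : 2 * R + 1 ≤ w) :
    1 ≤ clip R (a + w) - clip R a := by
  obtain ⟨h1, h2⟩ := abs_le.1 ha
  rw [clip, clip, min_eq_left (by linarith), min_eq_right (by linarith), max_eq_right (by linarith),
    max_eq_right h1]
  linarith

lemma truncExp_nonneg {K : ℝ} (hK : 0 ≤ K) (c a : ℝ) : 0 ≤ truncExp c K a :=
  le_min (Real.exp_pos _).le hK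

lemma truncExp_sub_le {c K R b w : ℝ} (hc : 0 ≤ c) (hb : |b| ≤ R) :
    truncExp c K (w - R) - Real.exp (c * R) ≤ truncExp c K (b + w) - truncExp c K b := by
  obtain ⟨h1, h2⟩ := abs_le.1 hb
  have e1 : truncExp c K (w - R) ≤ truncExp c K (b + w) := truncExp_monotone hc K (by linarith)
  have e2 : truncExp c K b ≤ Real.exp (c * R) :=
    (min_le_left _ _).trans (Real.exp_le_exp.2 (mul_le_mul_of_nonneg_left h2 hc))
  linarith

/-- A jump beyond 2R + 1 takes any point of [-R, R] beyond R + 1, so that the clipped coordinate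
grows by at least 1. All other jumps and axes contribute nonnegatively, both functions being
monotone in the same coordinate, and can be dropped. -/
lemma IsLevyMeasure.setIntegral_truncExp_le_jumpCov (hν : IsLevyMeasure ν) {r : ℝ} (hr : 0 < r)
    (hr1 : r ≤ 1) {σ : ℝ} (hσ : |σ| = 1) (k : Fin d) {c K R : ℝ} (hc : 0 ≤ c) (hR : 1 ≤ R)
    (hK : Real.exp (c * R) ≤ K) {x y : EuclideanSpace ℝ (Fin d)} (hx : ‖x‖ ≤ R) (hy : ‖y‖ ≤ R) :
    ∫ u in {u : EuclideanSpace ℝ (Fin d) | 2 * R + 1 < σ * u k},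
      (truncExp c K (σ * u k - R) - Real.exp (c * R)) ∂ν ≤
    jumpCov (axisMeasure ν r) (fun x => clip R (σ * x k)) (fun x => truncExp c K (σ * x k)) x y := by
  have hfin := fun k => hν.isFiniteMeasure_restrict hr k
  have hK0 : 0 ≤ K := (Real.exp_pos _).le.trans hK
  have hcoord : ∀ z : EuclideanSpace ℝ (Fin d), ‖z‖ ≤ R → |σ * z k| ≤ R := fun z hz => by
    rw [abs_mul, hσ, one_mul]
    exact (PiLp.norm_apply_le z k).trans hz
  set φ : EuclideanSpace ℝ (Fin d) → ℝ := fun u =>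
    (clip R (σ * (x + u) k) - clip R (σ * x k)) *
      (truncExp c K (σ * (y + u) k) - truncExp c K (σ * y k)) with hφ
  have hφ0 : ∀ u, 0 ≤ φ u := fun u => by
    simp only [hφ, PiLp.add_apply, mul_add]
    exact Monotone.mul_increments_nonneg (clip_monotone R) (truncExp_monotone hc K) _ _ _
  have hTb : ∀ a, |truncExp c K a| ≤ K := fun a => by
    rw [abs_of_nonneg (truncExp_nonneg hK0 _ _)]
    exact min_le_right _ _
  have hφm : Measurable φ := by
    refine Continuous.measurable ?_
    simp only [hφ, clip, truncExp]
    fun_prop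
  have hφC : ∀ u, ‖φ u‖ ≤ (2 * (R + 1)) * (2 * K) := fun u => by
    rw [norm_mul]
    have h1 := abs_clip_le (by linarith : 0 ≤ R)
    refine mul_le_mul ?_ ?_ (norm_nonneg _) (by linarith)
    · exact (abs_sub _ _).trans (by linarith [h1 (σ * (x + u) k), h1 (σ * x k)])
    · exact (abs_sub _ _).trans (by linarith [hTb (σ * (y + u) k), hTb (σ * y k)])
  rw [jumpCov, hν.integral_axisMeasure hr hφm.stronglyMeasurable hφC]
  have hm' : Measurable fun u : EuclideanSpace ℝ (Fin d) => φ (EuclideanSpace.single k (u k)) :=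
    hφm.comp (measurable_single_coord k)
  have hi : IntegrableOn (fun u : EuclideanSpace ℝ (Fin d) =>
      φ (EuclideanSpace.single k (u k))) {u | r < |u k|} ν :=
    Integrable.of_bound hm'.aestronglyMeasurable _ (ae_of_all _ fun u => hφC _)
  have hsub := lt_mul_coord_subset hσ (by linarith : r ≤ 2 * R + 1) k
  calc _ ≤ ∫ u in {u : EuclideanSpace ℝ (Fin d) | 2 * R + 1 < σ * u k},
        φ (EuclideanSpace.single k (u k)) ∂ν := by
        refine setIntegral_mono_on ?_ (hi.mono_set hsub) (measurableSet_lt_mul_coord _ _ _) ?_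
        · refine Integrable.mono' (g := fun _ => K + Real.exp (c * R)) ?_ ?_ (ae_of_all _ fun u => ?_)
          · have : IsFiniteMeasure (ν.restrict {u | 2 * R + 1 < σ * u k}) :=
              isFiniteMeasure_of_le _ (Measure.restrict_mono_set ν hsub)
            exact integrable_const _
          · refine Continuous.aestronglyMeasurable ?_
            simp only [truncExp]
            fun_prop
          · refine (norm_sub_le _ _).trans ?_
            rw [Real.norm_eq_abs, Real.norm_eq_abs, Real.abs_exp]
            linarith [hTb (σ * u k - R)]
        · intro u hu
          have hu' : 2 * R + 1 < σ * u k := hu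
          have e1 : (EuclideanSpace.single k (u k) : EuclideanSpace ℝ (Fin d)) k = u k := by simp
          simp only [hφ, PiLp.add_apply, e1, mul_add]
          have h1 := one_le_clip_sub (hcoord x hx) hu'.le
          have h2 := truncExp_sub_le (K := K) (w := σ * u k) hc (hcoord y hy)
          have h3 : 0 ≤ truncExp c K (σ * u k - R) - Real.exp (c * R) := by
            rw [sub_nonneg]
            refine le_min (Real.exp_le_exp.2 (mul_le_mul_of_nonneg_left ?_ hc)) hK
            linarith
          nlinarith
    _ ≤ ∫ u in {u : EuclideanSpace ℝ (Fin d) | r < |u k|},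
        φ (EuclideanSpace.single k (u k)) ∂ν :=
        setIntegral_mono_set hi (ae_of_all _ fun u => hφ0 _) (LE.le.eventuallyLE hsub)
    _ ≤ _ := Finset.single_le_sum (f := fun j => ∫ u in {u : EuclideanSpace ℝ (Fin d) | r < |u j|},
        φ (EuclideanSpace.single j (u j)) ∂ν)
        (fun j _ => integral_nonneg fun u => hφ0 _) (Finset.mem_univ k)

variable {Ω : Type*} [MeasurableSpace Ω] {P : Measure Ω} [IsProbabilityMeasure P]
  {X : Ω → EuclideanSpace ℝ (Fin d)} {γ : EuclideanSpace ℝ (Fin d)}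

/-- Half of the jump integral is at most the covariance of the clipped coordinate, bounded by R + 1,
and the truncated exponential g, hence at most 2(R + 1) E g. The resulting bound does not depend on
the truncation level K. -/
lemma IsIDVector.exists_setIntegral_truncExp_le (hX : IsIDVector P X γ ν)
    (hindep : iIndepFun (fun (k : Fin d) (ω : Ω) => X ω k) P) (k : Fin d) {c : ℝ} (hc : 0 ≤ c)
    (hexp : Integrable (fun ω => Real.exp (c * |X ω k|)) P) {σ : ℝ} (hσ : |σ| = 1) :
    ∃ R, 1 ≤ R ∧ ∀ K, Real.exp (c * R) ≤ K →
      ∫ u in {u : EuclideanSpace ℝ (Fin d) | 2 * R + 1 < σ * u k},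
        (truncExp c K (σ * u k - R) - Real.exp (c * R)) ∂ν ≤
      4 * (R + 1) * ∫ ω, Real.exp (c * |X ω k|) ∂P := by
  have hν := hX.isLevyMeasure
  have hμ : IsProbabilityMeasure (P.map X) := Measure.isProbabilityMeasure_map hX.aemeasurable
  obtain ⟨R, hR1, hR⟩ := exists_measure_norm_ge_lt (P.map X)
    (ENNReal.ofReal_pos.2 (by norm_num : (0 : ℝ) < 1 / 8))
  refine ⟨R, hR1, fun K hK => ?_⟩
  have hK0 : 0 ≤ K := (Real.exp_pos _).le.trans hK
  have := fun m : ℕ => hν.isFiniteMeasure_axisMeasure (Nat.one_div_pos_of_nat (α := ℝ) (n := m))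
  set f : EuclideanSpace ℝ (Fin d) → ℝ := fun x => clip R (σ * x k) with hf
  set g : EuclideanSpace ℝ (Fin d) → ℝ := fun x => truncExp c K (σ * x k) with hg
  have hfc : Continuous f := by
    simp only [hf, clip]
    fun_prop
  have hgc : Continuous g := by
    simp only [hg, truncExp]
    fun_prop
  have hfA : ∀ x, |f x| ≤ R + 1 := fun x => abs_clip_le (by linarith) _
  have hg0 : ∀ x, 0 ≤ g x := fun x => truncExp_nonneg hK0 _ _
  have hgB : ∀ x, |g x| ≤ K := fun x => by
    rw [abs_of_nonneg (hg0 x)]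
    exact min_le_right _ _
  have hr1 : ∀ m : ℕ, 1 / ((m : ℝ) + 1) ≤ 1 := fun m => by
    rw [div_le_one (by positivity)]
    linarith [(Nat.cast_nonneg m : (0 : ℝ) ≤ m)]
  have hC0 : 0 ≤ ∫ u in {u : EuclideanSpace ℝ (Fin d) | 2 * R + 1 < σ * u k},
        (truncExp c K (σ * u k - R) - Real.exp (c * R)) ∂ν := by
    refine setIntegral_nonneg (measurableSet_lt_mul_coord _ _ _) fun u hu => ?_
    have hu' : 2 * R + 1 < σ * u k := hu
    rw [sub_nonneg]
    refine le_min (Real.exp_le_exp.2 (mul_le_mul_of_nonneg_left ?_ hc)) hK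
    linarith
  have key := half_le_cov_of_le_jumpCov (κ := fun m : ℕ => axisMeasure ν (1 / ((m : ℝ) + 1)))
    (a := fun m : ℕ => axisDrift γ ν (1 / ((m : ℝ) + 1))) (hX.tendsto_charFun hindep)
    hfc hgc hfA hgB hC0 hR
    (fun m x y => integral_nonneg fun u => by
      simp only [hf, hg, PiLp.add_apply, mul_add]
      exact Monotone.mul_increments_nonneg (clip_monotone R) (truncExp_monotone hc K) _ _ _)
    (Eventually.of_forall fun m x y hx hy => hν.setIntegral_truncExp_le_jumpCov
      Nat.one_div_pos_of_nat (hr1 m) hσ k hc hR1 hK hx hy)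
  have hgi : Integrable g (P.map X) :=
    Integrable.of_bound hgc.aestronglyMeasurable K (ae_of_all _ hgB)
  have hgE : ∫ x, g x ∂(P.map X) ≤ ∫ ω, Real.exp (c * |X ω k|) ∂P := by
    rw [integral_map hX.aemeasurable hgc.aestronglyMeasurable]
    refine integral_mono (hgi.comp_aemeasurable hX.aemeasurable) hexp fun ω => ?_
    refine (min_le_left _ _).trans (Real.exp_le_exp.2 (mul_le_mul_of_nonneg_left ?_ hc))
    have := le_abs_self (σ * X ω k)
    rwa [abs_mul, hσ, one_mul] at this
  have hg1 : 0 ≤ ∫ x, g x ∂(P.map X) := integral_nonneg hg0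
  have h1 : ∫ x, f x * g x ∂(P.map X) ≤ (R + 1) * ∫ x, g x ∂(P.map X) := by
    rw [← integral_const_mul]
    refine integral_mono ?_ (hgi.const_mul _) fun x =>
      mul_le_mul_of_nonneg_right ((le_abs_self _).trans (hfA x)) (hg0 x)
    exact hgi.bdd_mul hfc.aestronglyMeasurable (ae_of_all _ hfA)
  have h2 : -(R + 1) ≤ ∫ x, f x ∂(P.map X) := by
    have := abs_integral_le_of_abs_le (P.map X) hfA
    rw [probReal_univ, mul_one] at this
    exact (abs_le.1 this).1
  nlinarith [mul_le_mul_of_nonneg_right h2 hg1,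
    mul_le_mul_of_nonneg_left hgE (by linarith : 0 ≤ 4 * (R + 1))]

lemma IsIDVector.lintegral_exp_lt_mul_coord_lt_top (hX : IsIDVector P X γ ν)
    (hindep : iIndepFun (fun (k : Fin d) (ω : Ω) => X ω k) P) (k : Fin d) {c : ℝ} (hc : 0 ≤ c)
    (hexp : Integrable (fun ω => Real.exp (c * |X ω k|)) P) {σ : ℝ} (hσ : |σ| = 1) :
    ∫⁻ u in {u : EuclideanSpace ℝ (Fin d) | 1 < σ * u k},
      ENNReal.ofReal (Real.exp (c * |u k|)) ∂ν < ∞ := by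
  have hν := hX.isLevyMeasure
  obtain ⟨R, hR1, hR⟩ := hX.exists_setIntegral_truncExp_le hindep k hc hexp hσ
  set B := 4 * (R + 1) * ∫ ω, Real.exp (c * |X ω k|) ∂P with hB
  set S := {u : EuclideanSpace ℝ (Fin d) | 2 * R + 1 < σ * u k} with hS
  have hSm : MeasurableSet S := measurableSet_lt_mul_coord _ _ _
  have hfin1 : IsFiniteMeasure (ν.restrict {u : EuclideanSpace ℝ (Fin d) | 1 < |u k|}) :=
    hν.isFiniteMeasure_restrict one_pos k
  have hfin : IsFiniteMeasure (ν.restrict {u : EuclideanSpace ℝ (Fin d) | 1 < σ * u k}) :=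
    isFiniteMeasure_of_le _ (Measure.restrict_mono_set ν (lt_mul_coord_subset hσ le_rfl k))
  have hfinS : IsFiniteMeasure (ν.restrict S) :=
    isFiniteMeasure_of_le _ (Measure.restrict_mono_set ν
      (lt_mul_coord_subset hσ (by linarith : (1 : ℝ) ≤ 2 * R + 1) k))
  have habs : ∀ u : EuclideanSpace ℝ (Fin d), |σ * u k| = |u k| := fun u => by
    rw [abs_mul, hσ, one_mul]
  have hmexp : Measurable fun u : EuclideanSpace ℝ (Fin d) =>
      Real.exp (c * (σ * u k - R)) - Real.exp (c * R) := Continuous.measurable (by fun_prop)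
  have htail : ∫⁻ u in S, ENNReal.ofReal (Real.exp (c * (σ * u k - R)) - Real.exp (c * R)) ∂ν ≤
      ENNReal.ofReal B := by
    have hmt : ∀ K : ℝ, Continuous fun u : EuclideanSpace ℝ (Fin d) =>
        truncExp c K (σ * u k - R) - Real.exp (c * R) := fun K => by
      simp only [truncExp]
      fun_prop
    -- At each u the truncation is inactive for large n, so that Fatou's lemma removes it. The
    -- levels e^{cR} + n are all admissible.
    have hlim : ∀ u : EuclideanSpace ℝ (Fin d),
        ENNReal.ofReal (Real.exp (c * (σ * u k - R)) - Real.exp (c * R)) ≤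
        liminf (fun n : ℕ => ENNReal.ofReal
          (truncExp c (Real.exp (c * R) + n) (σ * u k - R) - Real.exp (c * R))) atTop := by
      intro u
      refine le_liminf_of_le (by isBoundedDefault) ?_
      obtain ⟨N, hN⟩ := exists_nat_ge (Real.exp (c * (σ * u k - R)))
      filter_upwards [eventually_ge_atTop N] with n hn
      have : (N : ℝ) ≤ n := Nat.cast_le.2 hn
      rw [truncExp, min_eq_left (by linarith [Real.exp_pos (c * R)])]
    refine (lintegral_mono hlim).trans ((lintegral_liminf_le fun n =>
      (hmt _).measurable.ennreal_ofReal).trans ?_)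
    refine liminf_le_of_le (by isBoundedDefault) fun b hb => ?_
    obtain ⟨n, hn⟩ := hb.exists
    refine hn.trans ?_
    have hKn : Real.exp (c * R) ≤ Real.exp (c * R) + n := by
      linarith [(Nat.cast_nonneg n : (0 : ℝ) ≤ n)]
    have hK0 : 0 ≤ Real.exp (c * R) + n := (Real.exp_pos _).le.trans hKn
    rw [← ofReal_integral_eq_lintegral_ofReal]
    · exact ENNReal.ofReal_le_ofReal (hR _ hKn)
    · refine Integrable.of_bound (hmt _).aestronglyMeasurable
        (Real.exp (c * R) + n + Real.exp (c * R)) (ae_of_all _ fun u => ?_)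
      refine (norm_sub_le _ _).trans ?_
      rw [Real.norm_eq_abs, Real.norm_eq_abs, Real.abs_exp,
        abs_of_nonneg (truncExp_nonneg hK0 _ _)]
      exact add_le_add_left (min_le_right _ _) _
    · refine (ae_restrict_iff' hSm).2 (ae_of_all _ fun u hu => ?_)
      have hu' : 2 * R + 1 < σ * u k := hu
      change 0 ≤ _
      rw [sub_nonneg]
      refine le_min (Real.exp_le_exp.2 (mul_le_mul_of_nonneg_left ?_ hc)) hKn
      linarith
  -- With s = σ u_k, e^{cs} = e^{cR} (e^{c(s-R)} - e^{cR}) + e^{2cR} beyond 2R + 1. The remaining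
  -- jumps carry finite mass and a bounded integrand.
  have hpt : ∀ u ∈ {u : EuclideanSpace ℝ (Fin d) | 1 < σ * u k},
      ENNReal.ofReal (Real.exp (c * |u k|)) ≤
      ENNReal.ofReal (Real.exp (c * R)) * S.indicator (fun u => ENNReal.ofReal
        (Real.exp (c * (σ * u k - R)) - Real.exp (c * R))) u +
      ENNReal.ofReal (Real.exp (c * (2 * R + 1)) + Real.exp (c * R) ^ 2) := by
    intro u hu
    have hu' : 1 < σ * u k := hu
    have e : |u k| = σ * u k := by rw [← habs, abs_of_pos (by linarith)]
    by_cases hus : u ∈ S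
    · have hus' : 2 * R + 1 < σ * u k := hus
      have h3 : 0 ≤ Real.exp (c * (σ * u k - R)) - Real.exp (c * R) :=
        sub_nonneg.2 (Real.exp_le_exp.2 (mul_le_mul_of_nonneg_left (by linarith) hc))
      rw [indicator_of_mem hus, ← ENNReal.ofReal_mul (Real.exp_pos _).le,
        ← ENNReal.ofReal_add (mul_nonneg (Real.exp_pos _).le h3) (by positivity), e]
      refine ENNReal.ofReal_le_ofReal ?_
      have : Real.exp (c * (σ * u k)) = Real.exp (c * R) * Real.exp (c * (σ * u k - R)) := by
        rw [← Real.exp_add]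
        ring_nf
      rw [this]
      nlinarith [Real.exp_pos (c * (2 * R + 1))]
    · have hus' : σ * u k ≤ 2 * R + 1 := not_lt.1 hus
      rw [indicator_of_notMem hus, mul_zero, zero_add, e]
      refine ENNReal.ofReal_le_ofReal ?_
      have := Real.exp_le_exp.2 (mul_le_mul_of_nonneg_left hus' hc)
      nlinarith [sq_nonneg (Real.exp (c * R))]
  refine lt_of_le_of_lt (setLIntegral_mono' (measurableSet_lt_mul_coord _ _ _) hpt) ?_
  rw [lintegral_add_right _ measurable_const, lintegral_const_mul _
    (hmexp.ennreal_ofReal.indicator hSm), lintegral_const]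
  refine ENNReal.add_lt_top.2 ⟨ENNReal.mul_lt_top ENNReal.ofReal_lt_top ?_,
    ENNReal.mul_lt_top ENNReal.ofReal_lt_top (measure_lt_top _ _)⟩
  refine lt_of_le_of_lt (setLIntegral_le_lintegral _ _) ?_
  rw [lintegral_indicator hSm]
  exact lt_of_le_of_lt htail ENNReal.ofReal_lt_top

theorem IsIDVector.lintegral_exp_abs_coord_lt_top (hX : IsIDVector P X γ ν)
    (hindep : iIndepFun (fun (k : Fin d) (ω : Ω) => X ω k) P) (k : Fin d) {c : ℝ} (hc : 0 ≤ c)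
    (hexp : Integrable (fun ω => Real.exp (c * |X ω k|)) P) :
    ∫⁻ u in {u : EuclideanSpace ℝ (Fin d) | 1 < |u k|},
      ENNReal.ofReal (Real.exp (c * |u k|)) ∂ν < ∞ := by
  have h1 := hX.lintegral_exp_lt_mul_coord_lt_top hindep k hc hexp (σ := 1) (by norm_num)
  have h2 := hX.lintegral_exp_lt_mul_coord_lt_top hindep k hc hexp (σ := -1) (by norm_num)
  have hsub : {u : EuclideanSpace ℝ (Fin d) | 1 < |u k|} ⊆
      {u | 1 < 1 * u k} ∪ {u | 1 < -1 * u k} := fun u hu => by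
    rcases lt_abs.1 (show 1 < |u k| from hu) with h | h
    · exact Or.inl (by change 1 < 1 * u k; linarith)
    · exact Or.inr (by change 1 < -1 * u k; linarith)
  refine lt_of_le_of_lt (lintegral_mono_set hsub) (lt_of_le_of_lt (lintegral_union_le _ _ _) ?_)
  exact ENNReal.add_lt_top.2 ⟨h1, h2⟩

end ExponentialMoment

/-! ### Functions Lipschitz in each coordinate -/

section CoordinateLipschitz

variable {d : ℕ} {f : EuclideanSpace ℝ (Fin d) → ℝ} {b : Fin d → ℝ}

lemma nonneg_of_coord_lipschitz (hf : ∀ (k : Fin d) (u : ℝ) (x : EuclideanSpace ℝ (Fin d)),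
      |f (x + u • EuclideanSpace.single k (1 : ℝ)) - f x| ≤ b k * |u|) (k : Fin d) : 0 ≤ b k := by
  have := (abs_nonneg _).trans (hf k 1 0)
  simpa using this

/-- The coordinates are changed one at a time. -/
lemma abs_sub_le_sum_of_coord_lipschitz
    (hf : ∀ (k : Fin d) (u : ℝ) (x : EuclideanSpace ℝ (Fin d)),
      |f (x + u • EuclideanSpace.single k (1 : ℝ)) - f x| ≤ b k * |u|)
    (x y : EuclideanSpace ℝ (Fin d)) : |f y - f x| ≤ ∑ k, b k * |y k - x k| := by
  have key : ∀ s : Finset (Fin d), |f (x + ∑ k ∈ s, (y k - x k) • EuclideanSpace.single k (1 : ℝ)) -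
      f x| ≤ ∑ k ∈ s, b k * |y k - x k| := by
    intro s
    induction s using Finset.induction_on with
    | empty => simp
    | insert j s hj ih =>
      rw [Finset.sum_insert hj, Finset.sum_insert hj, add_comm (_ • _), ← add_assoc]
      exact (abs_sub_le _ _ _).trans (add_le_add (hf _ _ _) ih)
  have hy : x + ∑ k, (y k - x k) • EuclideanSpace.single k (1 : ℝ) = y := by
    ext j
    simp [WithLp.ofLp_sum, Finset.sum_apply, Pi.single_apply]
  have := key Finset.univ
  rwa [hy] at this

lemma continuous_of_coord_lipschitz
    (hf : ∀ (k : Fin d) (u : ℝ) (x : EuclideanSpace ℝ (Fin d)),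
      |f (x + u • EuclideanSpace.single k (1 : ℝ)) - f x| ≤ b k * |u|) : Continuous f := by
  refine continuous_iff_continuousAt.2 fun x => tendsto_iff_norm_sub_tendsto_zero.2 ?_
  have hc : Continuous fun y : EuclideanSpace ℝ (Fin d) => ∑ k, b k * |y k - x k| := by fun_prop
  have := hc.tendsto x
  simp only [sub_self, abs_zero, mul_zero, Finset.sum_const_zero] at this
  exact squeeze_zero (fun _ => norm_nonneg _)
    (fun y => abs_sub_le_sum_of_coord_lipschitz hf x y) this

end CoordinateLipschitz

/-! ### The slope (e^{ta} - 1)/a and finiteness of h_f -/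

lemma expSlope_nonneg {t a : ℝ} (ht : 0 ≤ t) (ha : 0 ≤ a) : 0 ≤ (Real.exp (t * a) - 1) / a :=
  div_nonneg (sub_nonneg.2 (Real.one_le_exp (mul_nonneg ht ha))) ha

/-- Slopes of the convex function e^{ta} from the origin increase; the multiplied form includes δ =
0 and a = 0. -/
lemma exp_sub_one_le_mul_expSlope {t δ a : ℝ} (hδ : 0 ≤ δ) (ha : δ ≤ a) :
    Real.exp (t * δ) - 1 ≤ δ * ((Real.exp (t * a) - 1) / a) := by
  rcases eq_or_lt_of_le (hδ.trans ha) with h0 | h0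
  · have : δ = 0 := le_antisymm (ha.trans h0.symm.le) hδ
    simp [this]
  · have h1 : δ / a ≤ 1 := (div_le_one h0).2 ha
    have := convexOn_exp.2 (mem_univ (t * a)) (mem_univ 0) (div_nonneg hδ h0.le)
      (sub_nonneg.2 h1) (by ring)
    simp only [smul_eq_mul, mul_zero, add_zero, Real.exp_zero, mul_one] at this
    have e : δ / a * (t * a) = t * δ := by field_simp
    rw [e] at this
    have e2 : δ * ((Real.exp (t * a) - 1) / a) = δ / a * Real.exp (t * a) - δ / a := by ring
    linarith

lemma abs_exp_sub_one_le_mul_expSlope {t δ a : ℝ} (ht : 0 ≤ t) (ha : |δ| ≤ a) :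
    |Real.exp (t * δ) - 1| ≤ |δ| * ((Real.exp (t * a) - 1) / a) := by
  refine le_trans ?_ (exp_sub_one_le_mul_expSlope (abs_nonneg δ) ha)
  have h1 : Real.exp (t * δ) ≤ Real.exp (t * |δ|) :=
    Real.exp_le_exp.2 (mul_le_mul_of_nonneg_left (le_abs_self δ) ht)
  have h2 : Real.exp (-(t * |δ|)) ≤ Real.exp (t * δ) :=
    Real.exp_le_exp.2 (by nlinarith [neg_abs_le δ])
  -- For negative δ, 1 - e^{-s} ≤ e^s - 1 is the inequality cosh s ≥ 1.
  have h3 : 2 ≤ Real.exp (t * |δ|) + Real.exp (-(t * |δ|)) := by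
    have := Real.one_le_cosh (t * |δ|)
    rw [Real.cosh_eq] at this
    linarith
  rw [abs_le]
  constructor <;> linarith

section JumpFunctional

variable {d : ℕ} {ν : Measure (EuclideanSpace ℝ (Fin d))} {b : Fin d → ℝ}
  {f : EuclideanSpace ℝ (Fin d) → ℝ}

/-- The integrand of the `k`-th term of `hfun`. -/
noncomputable def jumpTerm (b : Fin d → ℝ) (f : EuclideanSpace ℝ (Fin d) → ℝ) (t : ℝ)
    (x : EuclideanSpace ℝ (Fin d)) (k : Fin d) (u : ℝ) : ℝ :=
  |f (x + u • EuclideanSpace.single k (1 : ℝ)) - f x| ^ 2 *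
    ((Real.exp (t * b k * |u|) - 1) / (b k * |u|))

lemma hfun_eq (ν : Measure (EuclideanSpace ℝ (Fin d))) (b : Fin d → ℝ)
    (f : EuclideanSpace ℝ (Fin d) → ℝ) (t : ℝ) :
    hfun ν b f t = ⨆ x, ∑ k, ∫⁻ u, ENNReal.ofReal (jumpTerm b f t x k u)
      ∂(coordLevyMeasure ν k) := rfl

lemma jumpTerm_nonneg (hb : ∀ k, 0 ≤ b k) {t : ℝ} (ht : 0 ≤ t) (x : EuclideanSpace ℝ (Fin d))
    (k : Fin d) (u : ℝ) : 0 ≤ jumpTerm b f t x k u := by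
  rw [jumpTerm, mul_assoc]
  exact mul_nonneg (by positivity) (expSlope_nonneg ht (mul_nonneg (hb k) (abs_nonneg u)))

lemma measurable_jumpTerm (hf : Continuous f) (t : ℝ) (x : EuclideanSpace ℝ (Fin d)) (k : Fin d) :
    Measurable (jumpTerm b f t x k) := by
  unfold jumpTerm
  refine Measurable.mul (Continuous.measurable (by fun_prop)) (Measurable.div ?_ ?_)
  · exact Continuous.measurable (by fun_prop)
  · exact Continuous.measurable (by fun_prop)

lemma measurable_coord (k : Fin d) : Measurable fun u : EuclideanSpace ℝ (Fin d) => u k :=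
  Continuous.measurable (by fun_prop)

lemma lintegral_coordLevyMeasure (ν : Measure (EuclideanSpace ℝ (Fin d))) (k : Fin d)
    {φ : ℝ → ℝ≥0∞} (hφ : Measurable φ) :
    ∫⁻ s, φ s ∂(coordLevyMeasure ν k) = ∫⁻ u in {u | u k ≠ 0}, φ (u k) ∂ν := by
  rw [coordLevyMeasure, setLIntegral_map (measurableSet_singleton _).compl hφ (measurable_coord k)]
  rfl

/-- The bound is uniform in x, so that finiteness of its integral controls the supremum defining
h_f. -/
lemma jumpTerm_le (hf : ∀ (k : Fin d) (u : ℝ) (x : EuclideanSpace ℝ (Fin d)),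
      |f (x + u • EuclideanSpace.single k (1 : ℝ)) - f x| ≤ b k * |u|) {t : ℝ} (ht : 0 ≤ t)
    (x : EuclideanSpace ℝ (Fin d)) (k : Fin d) (u : ℝ) :
    jumpTerm b f t x k u ≤ b k * |u| * (Real.exp (t * (b k * |u|)) - 1) := by
  have ha : 0 ≤ b k * |u| := mul_nonneg (nonneg_of_coord_lipschitz hf k) (abs_nonneg u)
  rw [jumpTerm, mul_assoc]
  set a := b k * |u| with hadef
  have h1 : |f (x + u • EuclideanSpace.single k (1 : ℝ)) - f x| ^ 2 ≤ a ^ 2 :=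
    pow_le_pow_left₀ (abs_nonneg _) (hf k u x) 2
  refine (mul_le_mul_of_nonneg_right h1 (expSlope_nonneg ht ha)).trans_eq ?_
  rcases eq_or_lt_of_le ha with h0 | h0
  · rw [← h0]; simp
  · field_simp

lemma mul_exp_sub_one_le_of_le {t a c : ℝ} (ht : 0 ≤ t) (ha : 0 ≤ a) (hc : a ≤ c) :
    a * (Real.exp (t * a) - 1) ≤ t * Real.exp (t * c) * a ^ 2 := by
  have h1 : Real.exp (t * a) - 1 ≤ t * a * Real.exp (t * a) := by
    have := Real.add_one_le_exp (-(t * a))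
    have h2 : Real.exp (-(t * a)) * Real.exp (t * a) = 1 := by rw [← Real.exp_add]; simp
    nlinarith [Real.exp_pos (t * a)]
  have h2 : Real.exp (t * a) ≤ Real.exp (t * c) :=
    Real.exp_le_exp.2 (mul_le_mul_of_nonneg_left hc ht)
  calc a * (Real.exp (t * a) - 1) ≤ a * (t * a * Real.exp (t * a)) :=
        mul_le_mul_of_nonneg_left h1 ha
    _ = t * Real.exp (t * a) * a ^ 2 := by ring
    _ ≤ t * Real.exp (t * c) * a ^ 2 := by gcongr

lemma mul_exp_sub_one_le_exp {t t' a : ℝ} (ha : 0 ≤ a) (h : t < t') :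
    a * (Real.exp (t * a) - 1) ≤ (t' - t)⁻¹ * Real.exp (t' * a) := by
  have h0 : 0 < t' - t := sub_pos.2 h
  have h1 := (Real.add_one_le_exp ((t' - t) * a))
  have h2 : Real.exp (t' * a) = Real.exp ((t' - t) * a) * Real.exp (t * a) := by
    rw [← Real.exp_add]; ring_nf
  rw [h2, ← mul_assoc]
  have h3 : a ≤ (t' - t)⁻¹ * Real.exp ((t' - t) * a) := by
    rw [← div_eq_inv_mul, le_div_iff₀ h0]
    linarith
  have := mul_le_mul_of_nonneg_right h3 (Real.exp_pos (t * a)).le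
  linarith

variable {Ω : Type*} [MeasurableSpace Ω] {P : Measure Ω} [IsProbabilityMeasure P]
  {X : Ω → EuclideanSpace ℝ (Fin d)} {γ : EuclideanSpace ℝ (Fin d)}

/-- The integrand is quadratic for small jumps, where the Lévy condition applies. For large jumps
the gap t < t' absorbs the linear factor into e^{t'β|s|}, whose integral is finite by the
exponential moment of X_k. -/
theorem IsIDVector.lintegral_coordLevyMeasure_lt_top (hX : IsIDVector P X γ ν)
    (hindep : iIndepFun (fun (k : Fin d) (ω : Ω) => X ω k) P) (k : Fin d) {β t t' : ℝ}
    (hβ : 0 ≤ β) (ht : 0 ≤ t) (htt' : t < t')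
    (hexp : Integrable (fun ω => Real.exp (t' * β * |X ω k|)) P) :
    ∫⁻ s, ENNReal.ofReal (β * |s| * (Real.exp (t * (β * |s|)) - 1)) ∂(coordLevyMeasure ν k) < ∞ := by
  have hν := hX.isLevyMeasure
  have hm : Measurable fun s : ℝ => β * |s| * (Real.exp (t * (β * |s|)) - 1) :=
    Continuous.measurable (by fun_prop)
  rw [lintegral_coordLevyMeasure ν k hm.ennreal_ofReal]
  have hlev := hX.lintegral_exp_abs_coord_lt_top hindep k
    (mul_nonneg (ht.trans htt'.le) hβ) hexp
  have h0 : 0 < t' - t := sub_pos.2 htt'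
  set C := t * Real.exp (t * β) * β ^ 2 with hC
  have hC0 : 0 ≤ C := by positivity
  set S := {u : EuclideanSpace ℝ (Fin d) | 1 < |u k|} with hS
  have hSm : MeasurableSet S := measurableSet_lt_abs_coord 1 k
  have hpt : ∀ u : EuclideanSpace ℝ (Fin d),
      ENNReal.ofReal (β * |u k| * (Real.exp (t * (β * |u k|)) - 1)) ≤
      ENNReal.ofReal C * ENNReal.ofReal (min 1 (‖u‖ ^ 2)) + ENNReal.ofReal (t' - t)⁻¹ *
        S.indicator (fun u => ENNReal.ofReal (Real.exp (t' * β * |u k|))) u := by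
    intro u
    have ha : 0 ≤ β * |u k| := mul_nonneg hβ (abs_nonneg _)
    by_cases hu : u ∈ S
    · rw [indicator_of_mem hu, ← ENNReal.ofReal_mul (inv_pos.2 h0).le]
      refine le_trans (ENNReal.ofReal_le_ofReal ?_) le_add_self
      rw [mul_assoc t']
      exact mul_exp_sub_one_le_exp ha htt'
    · rw [indicator_of_notMem hu, mul_zero, add_zero, ← ENNReal.ofReal_mul hC0]
      refine ENNReal.ofReal_le_ofReal ?_
      have hu' : |u k| ≤ 1 := not_lt.1 hu
      refine (mul_exp_sub_one_le_of_le ht ha (mul_le_of_le_one_right hβ hu')).trans ?_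
      rw [mul_pow, ← mul_assoc, ← hC]
      refine mul_le_mul_of_nonneg_left (le_min (pow_le_one₀ (abs_nonneg _) hu') ?_) hC0
      exact pow_le_pow_left₀ (abs_nonneg _) (PiLp.norm_apply_le u k) 2
  refine lt_of_le_of_lt (setLIntegral_le_lintegral _ _) (lt_of_le_of_lt (lintegral_mono hpt) ?_)
  have m1 : Measurable fun u : EuclideanSpace ℝ (Fin d) => ENNReal.ofReal (min 1 (‖u‖ ^ 2)) := by
    fun_prop
  have m2 : Measurable fun u : EuclideanSpace ℝ (Fin d) =>
      ENNReal.ofReal (Real.exp (t' * β * |u k|)) :=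
    (Continuous.measurable (by fun_prop)).ennreal_ofReal
  rw [lintegral_add_left (m1.const_mul _), lintegral_const_mul _ m1,
    lintegral_const_mul _ (m2.indicator hSm), lintegral_indicator hSm]
  exact ENNReal.add_lt_top.2 ⟨ENNReal.mul_lt_top ENNReal.ofReal_lt_top hν.lintegral_lt_top,
    ENNReal.mul_lt_top ENNReal.ofReal_lt_top hlev⟩

theorem IsIDVector.hfun_lt_top (hX : IsIDVector P X γ ν)
    (hindep : iIndepFun (fun (k : Fin d) (ω : Ω) => X ω k) P)
    (hf : ∀ (k : Fin d) (u : ℝ) (x : EuclideanSpace ℝ (Fin d)),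
      |f (x + u • EuclideanSpace.single k (1 : ℝ)) - f x| ≤ b k * |u|)
    {t t' : ℝ} (ht : 0 ≤ t) (htt' : t < t')
    (hexp : ∀ k, Integrable (fun ω => Real.exp (t' * b k * |X ω k|)) P) :
    hfun ν b f t < ∞ := by
  rw [hfun_eq]
  refine lt_of_le_of_lt (iSup_le fun x => Finset.sum_le_sum fun k _ => lintegral_mono fun u =>
    ENNReal.ofReal_le_ofReal (jumpTerm_le hf ht x k u)) ?_
  exact ENNReal.sum_lt_top.2 fun k _ => hX.lintegral_coordLevyMeasure_lt_top hindep k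
    (nonneg_of_coord_lipschitz hf k) ht htt' (hexp k)

end JumpFunctional

/-! ### Convexity, continuity and strict monotonicity of h_f -/

lemma expSlope_convex {α β s t a : ℝ} (hα : 0 ≤ α) (hβ : 0 ≤ β) (hαβ : α + β = 1) (ha : 0 ≤ a) :
    (Real.exp ((α * s + β * t) * a) - 1) / a ≤
      α * ((Real.exp (s * a) - 1) / a) + β * ((Real.exp (t * a) - 1) / a) := by
  have := convexOn_exp.2 (mem_univ (s * a)) (mem_univ (t * a)) hα hβ hαβ
  simp only [smul_eq_mul] at this
  have e : (α * s + β * t) * a = α * (s * a) + β * (t * a) := by ring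
  rw [e, ← mul_div_assoc, ← mul_div_assoc, ← add_div]
  exact div_le_div_of_nonneg_right (by linarith) ha

section JumpFunctionalConvexity

variable {d : ℕ} {ν : Measure (EuclideanSpace ℝ (Fin d))} {b : Fin d → ℝ}
  {f : EuclideanSpace ℝ (Fin d) → ℝ}

lemma hfun_zero : hfun ν b f 0 = 0 := by
  simp [hfun]

/-- Convexity of t ↦ (e^{ta} - 1)/a survives integration against a positive measure, sums and
suprema. -/
lemma hfun_convex (hf : Continuous f) (hb : ∀ k, 0 ≤ b k) {α β s t : ℝ} (hα : 0 ≤ α) (hβ : 0 ≤ β)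
    (hαβ : α + β = 1) (hs : 0 ≤ s) (ht : 0 ≤ t) :
    hfun ν b f (α * s + β * t) ≤
      ENNReal.ofReal α * hfun ν b f s + ENNReal.ofReal β * hfun ν b f t := by
  rw [hfun_eq ν b f (α * s + β * t)]
  refine iSup_le fun x => ?_
  have key : ∀ k, ∫⁻ u, ENNReal.ofReal (jumpTerm b f (α * s + β * t) x k u)
      ∂(coordLevyMeasure ν k) ≤
      ENNReal.ofReal α * ∫⁻ u, ENNReal.ofReal (jumpTerm b f s x k u) ∂(coordLevyMeasure ν k) +
      ENNReal.ofReal β * ∫⁻ u, ENNReal.ofReal (jumpTerm b f t x k u) ∂(coordLevyMeasure ν k) := by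
    intro k
    have ms := (measurable_jumpTerm (b := b) hf s x k).ennreal_ofReal
    have mt := (measurable_jumpTerm (b := b) hf t x k).ennreal_ofReal
    rw [← lintegral_const_mul _ ms, ← lintegral_const_mul _ mt,
      ← lintegral_add_left (ms.const_mul _)]
    refine lintegral_mono fun u => ?_
    dsimp only
    have ns := jumpTerm_nonneg (f := f) hb hs x k u
    have nt := jumpTerm_nonneg (f := f) hb ht x k u
    rw [← ENNReal.ofReal_mul hα, ← ENNReal.ofReal_mul hβ, ← ENNReal.ofReal_add (by positivity)
      (by positivity)]
    refine ENNReal.ofReal_le_ofReal ?_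
    have h1 := expSlope_convex (s := s) (t := t) hα hβ hαβ (mul_nonneg (hb k) (abs_nonneg u))
    have h2 := mul_le_mul_of_nonneg_left h1
      (sq_nonneg |f (x + u • EuclideanSpace.single k (1 : ℝ)) - f x|)
    simp only [jumpTerm, mul_assoc] at h2 ⊢
    linarith
  refine (Finset.sum_le_sum fun k _ => key k).trans ?_
  rw [Finset.sum_add_distrib, ← Finset.mul_sum, ← Finset.mul_sum]
  exact add_le_add
    (mul_le_mul_right (le_iSup (fun x => ∑ k, ∫⁻ u, ENNReal.ofReal (jumpTerm b f s x k u)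
      ∂(coordLevyMeasure ν k)) x) _)
    (mul_le_mul_right (le_iSup (fun x => ∑ k, ∫⁻ u, ENNReal.ofReal (jumpTerm b f t x k u)
      ∂(coordLevyMeasure ν k)) x) _)

/-- For t > 0 the slope is positive when b_k|u| > 0, so that for almost every u either the increment
of f or b_k|u| vanishes. Neither condition involves t. -/
lemma hfun_eq_zero_of_eq_zero (hf : Continuous f) (hb : ∀ k, 0 ≤ b k) {t : ℝ} (ht : 0 < t)
    (h : hfun ν b f t = 0) (s : ℝ) : hfun ν b f s = 0 := by
  rw [hfun_eq] at h ⊢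
  refine le_antisymm (iSup_le fun x => (Finset.sum_eq_zero fun k _ => ?_).le) (zero_le)
  have h1 : ∑ k, ∫⁻ u, ENNReal.ofReal (jumpTerm b f t x k u) ∂(coordLevyMeasure ν k) = 0 :=
    le_antisymm (h ▸ le_iSup (fun x => ∑ k, ∫⁻ u, ENNReal.ofReal (jumpTerm b f t x k u)
      ∂(coordLevyMeasure ν k)) x) (zero_le)
  have h2 := (Finset.sum_eq_zero_iff_of_nonneg fun _ _ => zero_le).1 h1 k (Finset.mem_univ k)
  rw [lintegral_eq_zero_iff (measurable_jumpTerm hf t x k).ennreal_ofReal] at h2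
  rw [lintegral_eq_zero_iff (measurable_jumpTerm hf s x k).ennreal_ofReal]
  filter_upwards [h2] with u hu
  simp only [Pi.zero_apply, ENNReal.ofReal_eq_zero, jumpTerm, mul_assoc] at hu ⊢
  rcases eq_or_lt_of_le (mul_nonneg (hb k) (abs_nonneg u)) with h0 | h0
  · rw [← h0]; simp
  · have hpos : 0 < (Real.exp (t * (b k * |u|)) - 1) / (b k * |u|) :=
      div_pos (sub_pos.2 (Real.one_lt_exp_iff.2 (mul_pos ht h0))) h0
    have h3 := nonpos_of_mul_nonpos_left hu hpos
    have h4 : |f (x + u • EuclideanSpace.single k (1 : ℝ)) - f x| ^ 2 = 0 :=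
      le_antisymm h3 (sq_nonneg _)
    rw [h4, zero_mul]

variable {D : Set ℝ}

lemma convexOn_toReal_hfun (hf : Continuous f) (hb : ∀ k, 0 ≤ b k) (hD : Convex ℝ D)
    (hD0 : ∀ t ∈ D, 0 ≤ t) (hfin : ∀ t ∈ D, hfun ν b f t < ∞) :
    ConvexOn ℝ D fun t => (hfun ν b f t).toReal := by
  refine ⟨hD, fun s hs t ht α β hα hβ hαβ => ?_⟩
  have h1 := hfun_convex (ν := ν) hf hb hα hβ hαβ (hD0 s hs) (hD0 t ht)
  have h2 : ENNReal.ofReal α * hfun ν b f s ≠ ∞ :=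
    ENNReal.mul_ne_top ENNReal.ofReal_ne_top (hfin s hs).ne
  have h3 : ENNReal.ofReal β * hfun ν b f t ≠ ∞ :=
    ENNReal.mul_ne_top ENNReal.ofReal_ne_top (hfin t ht).ne
  have h4 := ENNReal.toReal_mono (ENNReal.add_ne_top.2 ⟨h2, h3⟩) h1
  rwa [ENNReal.toReal_add h2 h3, ENNReal.toReal_mul, ENNReal.toReal_mul, ENNReal.toReal_ofReal hα,
    ENNReal.toReal_ofReal hβ] at h4

end JumpFunctionalConvexity

section ConvexFunctions

variable {D : Set ℝ} {h : ℝ → ℝ}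

lemma ConvexOn.le_div_mul_of_zero (hc : ConvexOn ℝ D h) (h0D : (0 : ℝ) ∈ D) (h0 : h 0 = 0)
    {s t : ℝ} (ht : t ∈ D) (hs : 0 ≤ s) (hst : s ≤ t) (ht0 : 0 < t) : h s ≤ s / t * h t := by
  have h1 : s / t ≤ 1 := (div_le_one ht0).2 hst
  have := hc.2 ht h0D (div_nonneg hs ht0.le) (sub_nonneg.2 h1) (by ring)
  simp only [smul_eq_mul, mul_zero, add_zero, h0] at this
  rwa [div_mul_cancel₀ _ ht0.ne'] at this

lemma ConvexOn.strictMonoOn_of_zero (hc : ConvexOn ℝ D h) (h0D : (0 : ℝ) ∈ D) (h0 : h 0 = 0)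
    (hD0 : ∀ t ∈ D, 0 ≤ t) (hpos : ∀ t ∈ D, 0 < t → 0 < h t) : StrictMonoOn h D := by
  intro s hs t ht hst
  have h1 : 0 < t := (hD0 s hs).trans_lt hst
  refine (hc.le_div_mul_of_zero h0D h0 ht (hD0 s hs) hst.le h1).trans_lt ?_
  exact mul_lt_of_lt_one_left (hpos t ht h1) ((div_lt_one h1).2 hst)

/-- Convexity gives continuity in the interior, and the chord from the origin gives it at 0. The
absence of a largest element rules out a jump at a right end. -/
lemma ConvexOn.continuousOn_of_zero (hc : ConvexOn ℝ D h) (h0D : (0 : ℝ) ∈ D) (h0 : h 0 = 0)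
    (hD0 : ∀ t ∈ D, 0 ≤ t) (hpos : ∀ t ∈ D, 0 ≤ h t) (hopen : ∀ t ∈ D, ∃ t' ∈ D, t < t') :
    ContinuousOn h D := by
  intro t ht
  obtain ⟨t', ht', htt'⟩ := hopen t ht
  rcases eq_or_lt_of_le (hD0 t ht) with h1 | h1
  · subst h1
    have hlim : Tendsto (fun s : ℝ => s / t' * h t') (𝓝[D] 0) (𝓝 0) := by
      have : Continuous fun s : ℝ => s / t' * h t' := by fun_prop
      simpa using (this.tendsto 0).mono_left nhdsWithin_le_nhds
    rw [ContinuousWithinAt, h0]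
    refine squeeze_zero' ?_ ?_ hlim
    · filter_upwards [self_mem_nhdsWithin] with s hs using hpos s hs
    · filter_upwards [self_mem_nhdsWithin, mem_nhdsWithin_of_mem_nhds (Iio_mem_nhds htt')]
        with s hs hs'
      exact hc.le_div_mul_of_zero h0D h0 ht' (hD0 s hs) (le_of_lt hs') htt'
  · have hmem : Icc 0 t' ⊆ D := hc.1.ordConnected.out h0D ht'
    have hint : t ∈ interior D :=
      interior_mono hmem (by rw [interior_Icc]; exact ⟨h1, htt'⟩)
    exact ((hc.continuousOn_interior t hint).continuousAt
      (isOpen_interior.mem_nhds hint)).continuousWithinAt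

end ConvexFunctions

/-! ### The covariance of f and e^{tf}, and the Laplace transform -/

/-- Here α is an increment at one point and β at the other. The product is at most e^{ty} p q times
the slope at a, and pq ≤ (p² + q²)/2 decouples the points. Only q has to be compared with a. -/
lemma mul_exp_increment_le {t p q a α β y z : ℝ} (ht : 0 ≤ t) (hα : |α| ≤ p) (hβ : |β| ≤ q)
    (hqa : q ≤ a) (hz : z - y = β) :
    α * (Real.exp (t * z) - Real.exp (t * y)) ≤
      Real.exp (t * y) / 2 * (p ^ 2 * ((Real.exp (t * a) - 1) / a)) +
      Real.exp (t * y) / 2 * (q ^ 2 * ((Real.exp (t * a) - 1) / a)) := by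
  have ha : 0 ≤ a := (abs_nonneg β).trans (hβ.trans hqa)
  have hw := expSlope_nonneg ht ha
  set w := (Real.exp (t * a) - 1) / a with hwdef
  have hp : 0 ≤ p := (abs_nonneg _).trans hα
  have hq : 0 ≤ q := (abs_nonneg _).trans hβ
  have e1 : Real.exp (t * z) - Real.exp (t * y) = Real.exp (t * y) * (Real.exp (t * β) - 1) := by
    rw [mul_sub, ← Real.exp_add, ← hz]
    ring_nf
  have h1 : |Real.exp (t * β) - 1| ≤ q * w :=
    (abs_exp_sub_one_le_mul_expSlope ht (hβ.trans hqa)).trans (mul_le_mul_of_nonneg_right hβ hw)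
  have h2 : α * (Real.exp (t * β) - 1) ≤ p * (q * w) := by
    refine (le_abs_self _).trans ?_
    rw [abs_mul]
    exact mul_le_mul hα h1 (abs_nonneg _) hp
  have h3 : p * (q * w) ≤ (p ^ 2 * w + q ^ 2 * w) / 2 := by nlinarith [sq_nonneg (p - q)]
  calc α * (Real.exp (t * z) - Real.exp (t * y)) =
        Real.exp (t * y) * (α * (Real.exp (t * β) - 1)) := by rw [e1]; ring
    _ ≤ Real.exp (t * y) * ((p ^ 2 * w + q ^ 2 * w) / 2) :=
        mul_le_mul_of_nonneg_left (h2.trans h3) (Real.exp_pos _).le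
    _ = _ := by ring

section CovarianceExp

variable {d : ℕ} {ν : Measure (EuclideanSpace ℝ (Fin d))} {b : Fin d → ℝ}
  {f F : EuclideanSpace ℝ (Fin d) → ℝ}

lemma single_eq_smul_single_one (k : Fin d) (s : ℝ) :
    (EuclideanSpace.single k s : EuclideanSpace ℝ (Fin d)) =
      s • EuclideanSpace.single k (1 : ℝ) := by
  ext i
  simp

lemma setLIntegral_jumpTerm_le (hf : Continuous f) {r : ℝ} (hr : 0 < r) (t : ℝ)
    (x : EuclideanSpace ℝ (Fin d)) (k : Fin d) :
    ∫⁻ u in {u | r < |u k|}, ENNReal.ofReal (jumpTerm b f t x k (u k)) ∂ν ≤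
      ∫⁻ s, ENNReal.ofReal (jumpTerm b f t x k s) ∂(coordLevyMeasure ν k) := by
  rw [lintegral_coordLevyMeasure ν k (measurable_jumpTerm hf t x k).ennreal_ofReal]
  refine lintegral_mono_set fun u hu => ?_
  have hu' : r < |u k| := hu
  exact abs_pos.1 (hr.trans hu')

lemma sum_toReal_lintegral_jumpTerm_le {t : ℝ} (hfin : hfun ν b f t < ∞)
    (x : EuclideanSpace ℝ (Fin d)) :
    (∀ k, ∫⁻ s, ENNReal.ofReal (jumpTerm b f t x k s) ∂(coordLevyMeasure ν k) < ∞) ∧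
    ∑ k, (∫⁻ s, ENNReal.ofReal (jumpTerm b f t x k s) ∂(coordLevyMeasure ν k)).toReal ≤
      (hfun ν b f t).toReal := by
  have h1 : ∑ k, ∫⁻ s, ENNReal.ofReal (jumpTerm b f t x k s) ∂(coordLevyMeasure ν k) ≤
      hfun ν b f t := le_iSup (fun x => ∑ k, ∫⁻ u, ENNReal.ofReal (jumpTerm b f t x k u)
      ∂(coordLevyMeasure ν k)) x
  have h2 := fun k => ENNReal.sum_lt_top.1 (h1.trans_lt hfin) k (Finset.mem_univ k)
  refine ⟨h2, ?_⟩
  rw [← ENNReal.toReal_sum fun k _ => (h2 k).ne]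
  exact ENNReal.toReal_mono hfin.ne h1

/-- After decoupling, the terms at x and at y are each at most half of h_f(t) e^{tF(y)}. The second
hypothesis on F makes its increments no larger than those of f, as for truncations. -/
lemma IsLevyMeasure.jumpCov_exp_le (hν : IsLevyMeasure ν) {r : ℝ} (hr : 0 < r)
    (hf : ∀ (k : Fin d) (u : ℝ) (x : EuclideanSpace ℝ (Fin d)),
      |f (x + u • EuclideanSpace.single k (1 : ℝ)) - f x| ≤ b k * |u|)
    (hF : Continuous F) {K : ℝ} (hFK : ∀ x, |F x| ≤ K)
    (hFf : ∀ x y, |F y - F x| ≤ |f y - f x|) {t : ℝ} (ht : 0 ≤ t) (hfin : hfun ν b f t < ∞)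
    (x y : EuclideanSpace ℝ (Fin d)) :
    jumpCov (axisMeasure ν r) F (fun z => Real.exp (t * F z)) x y ≤
      (hfun ν b f t).toReal * Real.exp (t * F y) := by
  have hfc := continuous_of_coord_lipschitz hf
  have hb := nonneg_of_coord_lipschitz hf
  have hK0 : 0 ≤ K := (abs_nonneg _).trans (hFK x)
  have hfinr := fun k => hν.isFiniteMeasure_restrict hr k
  have hgB : ∀ z, |Real.exp (t * F z)| ≤ Real.exp (t * K) := fun z => by
    rw [Real.abs_exp]
    exact Real.exp_le_exp.2 (mul_le_mul_of_nonneg_left ((le_abs_self _).trans (hFK z)) ht)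
  set φ : EuclideanSpace ℝ (Fin d) → ℝ := fun u =>
    (F (x + u) - F x) * (Real.exp (t * F (y + u)) - Real.exp (t * F y)) with hφ
  have hφm : Measurable φ := by
    refine Continuous.measurable ?_
    simp only [hφ]
    fun_prop
  have hφC : ∀ u, ‖φ u‖ ≤ (2 * K) * (2 * Real.exp (t * K)) := fun u => by
    rw [norm_mul]
    refine mul_le_mul ?_ ?_ (norm_nonneg _) (by linarith)
    · exact (abs_sub _ _).trans (by linarith [hFK (x + u), hFK x])
    · exact (abs_sub _ _).trans (by linarith [hgB (y + u), hgB y])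
  rw [jumpCov, hν.integral_axisMeasure hr hφm.stronglyMeasurable hφC]
  have hJ : ∀ z k, Integrable (fun u : EuclideanSpace ℝ (Fin d) => jumpTerm b f t z k (u k))
      (ν.restrict {u | r < |u k|}) ∧
      ∫ u in {u | r < |u k|}, jumpTerm b f t z k (u k) ∂ν ≤
      (∫⁻ s, ENNReal.ofReal (jumpTerm b f t z k s) ∂(coordLevyMeasure ν k)).toReal := by
    intro z k
    have hm := ((measurable_jumpTerm (b := b) hfc t z k).comp
      (measurable_coord k)).aestronglyMeasurable (μ := ν.restrict {u | r < |u k|})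
    have h0 : ∀ u : EuclideanSpace ℝ (Fin d), 0 ≤ jumpTerm b f t z k (u k) := fun u =>
      jumpTerm_nonneg hb ht z k _
    have hlt := (sum_toReal_lintegral_jumpTerm_le hfin z).1 k
    have hle := setLIntegral_jumpTerm_le (ν := ν) (b := b) hfc hr t z k
    refine ⟨⟨hm, ?_⟩, ?_⟩
    · rw [hasFiniteIntegral_iff_ofReal (ae_of_all _ h0)]
      exact hle.trans_lt hlt
    · rw [integral_eq_lintegral_of_nonneg_ae (ae_of_all _ h0) hm]
      exact ENNReal.toReal_mono hlt.ne hle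
  have key : ∀ k, ∫ u in {u | r < |u k|}, φ (EuclideanSpace.single k (u k)) ∂ν ≤
      Real.exp (t * F y) / 2 *
        (∫⁻ s, ENNReal.ofReal (jumpTerm b f t x k s) ∂(coordLevyMeasure ν k)).toReal +
      Real.exp (t * F y) / 2 *
        (∫⁻ s, ENNReal.ofReal (jumpTerm b f t y k s) ∂(coordLevyMeasure ν k)).toReal := by
    intro k
    have i1 := (hJ x k).1.const_mul (Real.exp (t * F y) / 2)
    have i2 := (hJ y k).1.const_mul (Real.exp (t * F y) / 2)
    have hpos : 0 ≤ Real.exp (t * F y) / 2 := by positivity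
    calc _ ≤ ∫ u in {u | r < |u k|}, (Real.exp (t * F y) / 2 * jumpTerm b f t x k (u k) +
          Real.exp (t * F y) / 2 * jumpTerm b f t y k (u k)) ∂ν := by
          refine integral_mono ?_ (i1.add i2) fun u => ?_
          · exact Integrable.of_bound
              (hφm.comp (measurable_single_coord k)).aestronglyMeasurable _
              (ae_of_all _ fun u => hφC _)
          · simp only [hφ, jumpTerm, single_eq_smul_single_one k (u k), mul_assoc]
            exact mul_exp_increment_le ht (hFf _ _) (hFf _ _) (hf k (u k) y) rfl
      _ ≤ _ := by
          rw [integral_add i1 i2, integral_const_mul, integral_const_mul]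
          exact add_le_add (mul_le_mul_of_nonneg_left (hJ x k).2 hpos)
            (mul_le_mul_of_nonneg_left (hJ y k).2 hpos)
  refine (Finset.sum_le_sum fun k _ => key k).trans ?_
  rw [Finset.sum_add_distrib, ← Finset.mul_sum, ← Finset.mul_sum]
  have hx := (sum_toReal_lintegral_jumpTerm_le hfin x).2
  have hy := (sum_toReal_lintegral_jumpTerm_le hfin y).2
  have hpos : 0 ≤ Real.exp (t * F y) / 2 := by positivity
  have h1 := mul_le_mul_of_nonneg_left hx hpos
  have h2 := mul_le_mul_of_nonneg_left hy hpos
  linarith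

variable {Ω : Type*} [MeasurableSpace Ω] {P : Measure Ω} [IsProbabilityMeasure P]
  {X : Ω → EuclideanSpace ℝ (Fin d)} {γ : EuclideanSpace ℝ (Fin d)}

theorem IsIDVector.cov_exp_le (hX : IsIDVector P X γ ν)
    (hindep : iIndepFun (fun (k : Fin d) (ω : Ω) => X ω k) P)
    (hf : ∀ (k : Fin d) (u : ℝ) (x : EuclideanSpace ℝ (Fin d)),
      |f (x + u • EuclideanSpace.single k (1 : ℝ)) - f x| ≤ b k * |u|)
    (hF : Continuous F) {K : ℝ} (hFK : ∀ x, |F x| ≤ K)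
    (hFf : ∀ x y, |F y - F x| ≤ |f y - f x|) {t : ℝ} (ht : 0 ≤ t) (hfin : hfun ν b f t < ∞) :
    ∫ x, F x * Real.exp (t * F x) ∂(P.map X) -
      (∫ x, F x ∂(P.map X)) * ∫ x, Real.exp (t * F x) ∂(P.map X) ≤
      (hfun ν b f t).toReal * ∫ x, Real.exp (t * F x) ∂(P.map X) := by
  have hν := hX.isLevyMeasure
  have hμ : IsProbabilityMeasure (P.map X) := Measure.isProbabilityMeasure_map hX.aemeasurable
  have := fun m : ℕ => hν.isFiniteMeasure_axisMeasure (Nat.one_div_pos_of_nat (α := ℝ) (n := m))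
  refine cov_le_of_jumpCov_le (κ := fun m : ℕ => axisMeasure ν (1 / ((m : ℝ) + 1)))
    (a := fun m : ℕ => axisDrift γ ν (1 / ((m : ℝ) + 1))) (hX.tendsto_charFun hindep)
    hF (by fun_prop) hFK (B := Real.exp (t * K)) (fun z => ?_) ENNReal.toReal_nonneg
    (fun z => (Real.exp_pos _).le)
    (fun m x y => hν.jumpCov_exp_le Nat.one_div_pos_of_nat hf hF hFK hFf ht hfin x y)
  rw [Real.abs_exp]
  exact Real.exp_le_exp.2 (mul_le_mul_of_nonneg_left ((le_abs_self _).trans (hFK z)) ht)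

/-- The derivative of log E e^{sF} is E[F e^{sF}] / E e^{sF}, which the covariance bound makes at
most E F + h_f(s). Boundedness of F makes the logarithm differentiable everywhere. -/
theorem IsIDVector.integral_exp_le_of_bounded (hX : IsIDVector P X γ ν)
    (hindep : iIndepFun (fun (k : Fin d) (ω : Ω) => X ω k) P)
    (hf : ∀ (k : Fin d) (u : ℝ) (x : EuclideanSpace ℝ (Fin d)),
      |f (x + u • EuclideanSpace.single k (1 : ℝ)) - f x| ≤ b k * |u|)
    (hF : Continuous F) {K : ℝ} (hFK : ∀ x, |F x| ≤ K)
    (hFf : ∀ x y, |F y - F x| ≤ |f y - f x|) {t : ℝ} (ht : 0 ≤ t)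
    (hfin : ∀ s ∈ Icc 0 t, hfun ν b f s < ∞)
    (hint : IntegrableOn (fun s => (hfun ν b f s).toReal) (Icc 0 t)) :
    ∫ x, Real.exp (t * (F x - ∫ z, F z ∂(P.map X))) ∂(P.map X) ≤
      Real.exp (∫ s in (0 : ℝ)..t, (hfun ν b f s).toReal) := by
  have hμ : IsProbabilityMeasure (P.map X) := Measure.isProbabilityMeasure_map hX.aemeasurable
  set μ := P.map X with hμdef
  have hexp : ∀ s : ℝ, Integrable (fun x => Real.exp (s * F x)) μ := fun s => by
    refine Integrable.of_bound (Continuous.aestronglyMeasurable (by fun_prop))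
      (Real.exp (|s| * K)) (ae_of_all _ fun z => ?_)
    rw [Real.norm_eq_abs, Real.abs_exp]
    refine Real.exp_le_exp.2 ((le_abs_self _).trans ?_)
    rw [abs_mul]
    exact mul_le_mul_of_nonneg_left (hFK z) (abs_nonneg s)
  have hset : interior (integrableExpSet F μ) = univ := by
    rw [eq_univ_of_forall (s := integrableExpSet F μ) hexp, interior_univ]
  have hcgf : ∀ s, HasDerivAt (fun s => cgf F μ s - s * ∫ z, F z ∂μ)
      (μ[fun x => F x * Real.exp (s * F x)] / mgf F μ s - ∫ z, F z ∂μ) s := by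
    intro s
    have hs : s ∈ interior (integrableExpSet F μ) := by rw [hset]; trivial
    have h1 : HasDerivAt (cgf F μ) (μ[fun x => F x * Real.exp (s * F x)] / mgf F μ s) s := by
      rw [← deriv_cgf hs]
      exact (analyticAt_cgf hs).differentiableAt.hasDerivAt
    have h2 : HasDerivAt (fun s => s * ∫ z, F z ∂μ) (∫ z, F z ∂μ) s := by
      simpa using (hasDerivAt_id s).mul_const (∫ z, F z ∂μ)
    exact h1.sub h2
  have hle : ∀ s ∈ Ioo 0 t, μ[fun x => F x * Real.exp (s * F x)] / mgf F μ s - ∫ z, F z ∂μ ≤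
      (hfun ν b f s).toReal := by
    intro s hs
    have hpos : 0 < mgf F μ s := mgf_pos (hexp s)
    have h1 := hX.cov_exp_le hindep hf hF hFK hFf hs.1.le (hfin s (Ioo_subset_Icc_self hs))
    rw [sub_le_iff_le_add, div_le_iff₀ hpos]
    have h2 : mgf F μ s = ∫ x, Real.exp (s * F x) ∂μ := rfl
    rw [h2]
    linarith
  have hmain := intervalIntegral.sub_le_integral_of_hasDeriv_right_of_le ht
    (fun s _ => (hcgf s).continuousAt.continuousWithinAt)
    (fun s _ => (hcgf s).hasDerivWithinAt) hint hle
  simp only [cgf_zero, zero_mul, sub_zero] at hmain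
  refine le_trans (le_of_eq ?_) (Real.exp_le_exp.2 hmain)
  rw [Real.exp_sub, exp_cgf (hexp t), mgf, div_eq_mul_inv, ← Real.exp_neg, ← integral_mul_const]
  refine integral_congr_ae (ae_of_all _ fun x => ?_)
  dsimp only
  rw [← Real.exp_add]
  ring_nf

lemma abs_max_min_le_abs {K : ℝ} (hK : 0 ≤ K) (a : ℝ) : |max (-K) (min a K)| ≤ |a| := by
  rw [abs_le]
  refine ⟨?_, max_le (by linarith [abs_nonneg a]) ((min_le_left _ _).trans (le_abs_self a))⟩
  rcases le_total a K with h | h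
  · rw [min_eq_left h]
    exact (neg_abs_le a).trans (le_max_right _ _)
  · rw [min_eq_right h]
    exact le_trans (by linarith [abs_nonneg a]) (le_max_right _ _)

lemma abs_max_min_sub_le (K a c : ℝ) :
    |max (-K) (min a K) - max (-K) (min c K)| ≤ |a - c| := by
  refine (abs_max_sub_max_le_max _ _ _ _).trans (max_le (by simp) ?_)
  exact (abs_min_sub_min_le_max _ _ _ _).trans (max_le le_rfl (by simp))

/-- The bound is the same for all truncations of f. Their means converge by domination, and Fatou's
lemma yields both integrability and the inequality. -/
theorem IsIDVector.integral_exp_le (hX : IsIDVector P X γ ν)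
    (hindep : iIndepFun (fun (k : Fin d) (ω : Ω) => X ω k) P)
    (hf : ∀ (k : Fin d) (u : ℝ) (x : EuclideanSpace ℝ (Fin d)),
      |f (x + u • EuclideanSpace.single k (1 : ℝ)) - f x| ≤ b k * |u|)
    (hfi : Integrable f (P.map X)) {t : ℝ} (ht : 0 ≤ t)
    (hfin : ∀ s ∈ Icc 0 t, hfun ν b f s < ∞)
    (hint : IntegrableOn (fun s => (hfun ν b f s).toReal) (Icc 0 t)) :
    Integrable (fun x => Real.exp (t * (f x - ∫ z, f z ∂(P.map X)))) (P.map X) ∧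
    ∫ x, Real.exp (t * (f x - ∫ z, f z ∂(P.map X))) ∂(P.map X) ≤
      Real.exp (∫ s in (0 : ℝ)..t, (hfun ν b f s).toReal) := by
  have hμ : IsProbabilityMeasure (P.map X) := Measure.isProbabilityMeasure_map hX.aemeasurable
  have hfc := continuous_of_coord_lipschitz hf
  set μ := P.map X with hμdef
  set F : ℕ → EuclideanSpace ℝ (Fin d) → ℝ := fun n x => max (-(n : ℝ)) (min (f x) n) with hF
  have hFc : ∀ n, Continuous (F n) := fun n => by simp only [hF]; fun_prop
  have hFK : ∀ n x, |F n x| ≤ n := fun n x => by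
    have : (0 : ℝ) ≤ n := Nat.cast_nonneg n
    rw [abs_le]
    exact ⟨le_max_left _ _, max_le (by linarith) (min_le_right _ _)⟩
  have hFt : ∀ x, Tendsto (fun n => F n x) atTop (𝓝 (f x)) := fun x => by
    obtain ⟨N, hN⟩ := exists_nat_ge |f x|
    refine tendsto_const_nhds.congr' ?_
    filter_upwards [eventually_ge_atTop N] with n hn
    have h1 : (N : ℝ) ≤ n := Nat.cast_le.2 hn
    obtain ⟨h2, h3⟩ := abs_le.1 (hN.trans h1)
    simp only [hF]
    rw [min_eq_left h3, max_eq_right h2]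
  have hEt : Tendsto (fun n => ∫ z, F n z ∂μ) atTop (𝓝 (∫ z, f z ∂μ)) :=
    tendsto_integral_of_dominated_convergence (fun x => |f x|)
      (fun n => (hFc n).aestronglyMeasurable) hfi.abs
      (fun n => ae_of_all _ fun x => abs_max_min_le_abs (Nat.cast_nonneg n) (f x))
      (ae_of_all _ hFt)
  have hb := fun n => hX.integral_exp_le_of_bounded hindep hf (hFc n) (hFK n)
    (fun x y => abs_max_min_sub_le _ _ _) ht hfin hint
  set B := Real.exp (∫ s in (0 : ℝ)..t, (hfun ν b f s).toReal) with hB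
  have hm : AEStronglyMeasurable (fun x => Real.exp (t * (f x - ∫ z, f z ∂μ))) μ :=
    Continuous.aestronglyMeasurable (by fun_prop)
  have hlint : ∫⁻ x, ENNReal.ofReal (Real.exp (t * (f x - ∫ z, f z ∂μ))) ∂μ ≤
      ENNReal.ofReal B := by
    have hlim : ∀ x, ENNReal.ofReal (Real.exp (t * (f x - ∫ z, f z ∂μ))) ≤
        liminf (fun n => ENNReal.ofReal (Real.exp (t * (F n x - ∫ z, F n z ∂μ)))) atTop := by
      intro x
      have h1 : Tendsto (fun n => ENNReal.ofReal (Real.exp (t * (F n x - ∫ z, F n z ∂μ)))) atTop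
          (𝓝 (ENNReal.ofReal (Real.exp (t * (f x - ∫ z, f z ∂μ))))) :=
        ENNReal.tendsto_ofReal ((Real.continuous_exp.tendsto _).comp
          (((hFt x).sub hEt).const_mul t))
      exact h1.liminf_eq.ge
    refine (lintegral_mono hlim).trans ((lintegral_liminf_le fun n => ?_).trans ?_)
    · exact (Continuous.measurable (by have := hFc n; fun_prop)).ennreal_ofReal
    refine liminf_le_of_le (by isBoundedDefault) fun c hc => ?_
    obtain ⟨n, hn⟩ := hc.exists
    refine hn.trans ?_
    rw [← ofReal_integral_eq_lintegral_ofReal]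
    · exact ENNReal.ofReal_le_ofReal (hb n)
    · refine Integrable.of_bound (Continuous.aestronglyMeasurable (by have := hFc n; fun_prop))
        (Real.exp (t * (n - ∫ z, F n z ∂μ))) (ae_of_all _ fun x => ?_)
      rw [Real.norm_eq_abs, Real.abs_exp]
      exact Real.exp_le_exp.2 (mul_le_mul_of_nonneg_left
        (sub_le_sub_right ((le_abs_self _).trans (hFK n x)) _) ht)
    · exact ae_of_all _ fun x => (Real.exp_pos _).le
  have h0 : ∀ x, 0 ≤ Real.exp (t * (f x - ∫ z, f z ∂μ)) := fun x => (Real.exp_pos _).le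
  refine ⟨⟨hm, ?_⟩, ?_⟩
  · rw [hasFiniteIntegral_iff_ofReal (ae_of_all _ h0)]
    exact hlint.trans_lt ENNReal.ofReal_lt_top
  · rw [integral_eq_lintegral_of_nonneg_ae (ae_of_all _ h0) hm]
    exact ENNReal.toReal_le_of_le_ofReal (Real.exp_pos _).le hlint

end CovarianceExp

/-! ### Young's equality for an increasing function and its inverse -/

/-- The equality case of Young's inequality for an increasing function and its inverse. -/
theorem integral_leftInverse_eq {h g : ℝ → ℝ} {τ x : ℝ} (hτ : 0 ≤ τ)
    (hc : ContinuousOn h (Icc 0 τ)) (hm : StrictMonoOn h (Icc 0 τ)) (h0 : h 0 = 0) (hx : h τ = x)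
    (hg : ∀ r ∈ Icc 0 τ, g (h r) = r) :
    IntervalIntegrable g volume 0 x ∧ ∫ s in (0 : ℝ)..x, g s = τ * x - ∫ r in (0 : ℝ)..τ, h r := by
  have m0 : (0 : ℝ) ∈ Icc 0 τ := left_mem_Icc.2 hτ
  have mτ : τ ∈ Icc 0 τ := right_mem_Icc.2 hτ
  have hx0 : 0 ≤ x := by
    rw [← hx, ← h0]
    exact hm.monotoneOn m0 mτ hτ
  have hsurj : ∀ s ∈ Icc 0 x, ∃ r ∈ Icc 0 τ, h r = s := fun s hs => by
    have := intermediate_value_Icc hτ hc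
    rw [h0, hx] at this
    exact this hs
  have hgm : MonotoneOn g (uIcc 0 x) := by
    rw [uIcc_of_le hx0]
    intro s hs s' hs' hss
    obtain ⟨r, hr, rfl⟩ := hsurj s hs
    obtain ⟨r', hr', rfl⟩ := hsurj s' hs'
    rw [hg r hr, hg r' hr']
    exact (hm.le_iff_le hr hr').1 hss
  have hgi : IntervalIntegrable g volume 0 x := hgm.intervalIntegrable
  have hhi : IntervalIntegrable h volume 0 τ := ContinuousOn.intervalIntegrable (by
    rwa [uIcc_of_le hτ])
  refine ⟨hgi, ?_⟩
  -- Freezing h outside [0, τ] gives a function continuous on the whole line, which makes the region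
  -- below measurable.
  set H : ℝ → ℝ := fun r => h (projIcc 0 τ hτ r) with hH
  have hHc : Continuous H := (continuousOn_iff_continuous_domRestrict.1 hc).comp continuous_projIcc
  have hHh : ∀ r ∈ Icc 0 τ, H r = h r := fun r hr => by simp only [hH, projIcc_of_mem hτ hr]
  -- The part of the rectangle above the graph. Its slice at height s has length g(s), its slice at
  -- abscissa r has length x - h(r); Fubini compares the two areas.
  set S : Set (ℝ × ℝ) := (Ioc 0 τ ×ˢ Ioc 0 x) ∩ {p | H p.1 < p.2} with hS
  have hSm : MeasurableSet S := (measurableSet_Ioc.prod measurableSet_Ioc).inter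
    (isOpen_lt (hHc.comp continuous_fst) continuous_snd).measurableSet
  have e1 : (volume : Measure (ℝ × ℝ)) S = ∫⁻ s in Ioc 0 x, ENNReal.ofReal (g s) := by
    rw [Measure.volume_eq_prod, Measure.prod_apply_symm hSm, ← lintegral_indicator measurableSet_Ioc]
    refine lintegral_congr fun s => ?_
    by_cases hs : s ∈ Ioc 0 x
    · rw [indicator_of_mem hs]
      obtain ⟨r0, hr0, hr0s⟩ := hsurj s (Ioc_subset_Icc_self hs)
      have : (fun r => (r, s)) ⁻¹' S = Ioo 0 r0 := by
        ext r
        constructor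
        · rintro ⟨⟨hr, _⟩, hlt⟩
          have hlt' : H r < s := hlt
          rw [hHh r (Ioc_subset_Icc_self hr), ← hr0s,
            hm.lt_iff_lt (Ioc_subset_Icc_self hr) hr0] at hlt'
          exact ⟨hr.1, hlt'⟩
        · rintro ⟨h1, h2⟩
          have hr : r ∈ Ioc 0 τ := ⟨h1, h2.le.trans hr0.2⟩
          refine ⟨⟨hr, hs⟩, ?_⟩
          change H r < s
          rw [hHh r (Ioc_subset_Icc_self hr), ← hr0s, hm.lt_iff_lt (Ioc_subset_Icc_self hr) hr0]
          exact h2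
      rw [this, Real.volume_Ioo, sub_zero, ← hr0s, hg r0 hr0]
    · rw [indicator_of_notMem hs]
      have : (fun r => (r, s)) ⁻¹' S = ∅ := eq_empty_of_forall_notMem fun r hr => hs hr.1.2
      rw [this, measure_empty]
  have e2 : (volume : Measure (ℝ × ℝ)) S = ∫⁻ r in Ioc 0 τ, ENNReal.ofReal (x - h r) := by
    rw [Measure.volume_eq_prod, Measure.prod_apply hSm, ← lintegral_indicator measurableSet_Ioc]
    refine lintegral_congr fun r => ?_
    by_cases hr : r ∈ Ioc 0 τ
    · rw [indicator_of_mem hr]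
      have hr' := Ioc_subset_Icc_self hr
      have hr0 : 0 ≤ h r := by
        rw [← h0]
        exact hm.monotoneOn m0 hr' hr'.1
      have : Prod.mk r ⁻¹' S = Ioc (h r) x := by
        ext s
        constructor
        · rintro ⟨⟨_, hs⟩, hlt⟩
          have hlt' : H r < s := hlt
          rw [hHh r hr'] at hlt'
          exact ⟨hlt', hs.2⟩
        · rintro ⟨h1, h2⟩
          refine ⟨⟨hr, hr0.trans_lt h1, h2⟩, ?_⟩
          change H r < s
          rwa [hHh r hr']
      rw [this, Real.volume_Ioc]
    · rw [indicator_of_notMem hr]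
      have : Prod.mk r ⁻¹' S = ∅ := eq_empty_of_forall_notMem fun s hs => hr hs.1.1
      rw [this, measure_empty]
  have e3 : ∫ s in (0 : ℝ)..x, g s = (∫⁻ s in Ioc 0 x, ENNReal.ofReal (g s)).toReal := by
    rw [intervalIntegral.integral_of_le hx0]
    refine integral_eq_lintegral_of_nonneg_ae ((ae_restrict_iff' measurableSet_Ioc).2
      (ae_of_all _ fun s hs => ?_)) hgi.1.aestronglyMeasurable
    obtain ⟨r, hr, rfl⟩ := hsurj s (Ioc_subset_Icc_self hs)
    rw [hg r hr]
    exact hr.1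
  have e4 : ∫ r in (0 : ℝ)..τ, (x - h r) =
      (∫⁻ r in Ioc 0 τ, ENNReal.ofReal (x - h r)).toReal := by
    rw [intervalIntegral.integral_of_le hτ]
    refine integral_eq_lintegral_of_nonneg_ae ((ae_restrict_iff' measurableSet_Ioc).2
      (ae_of_all _ fun r hr => ?_)) (intervalIntegrable_const.sub hhi).1.aestronglyMeasurable
    have hr' := Ioc_subset_Icc_self hr
    exact sub_nonneg.2 (hx ▸ hm.monotoneOn hr' mτ hr'.2)
  rw [e3, ← e1, e2, ← e4, intervalIntegral.integral_sub intervalIntegrable_const hhi,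
    intervalIntegral.integral_const, sub_zero, smul_eq_mul]

/-! ### The threshold M and the final assembly -/

section Assembly

variable {Ω : Type*} [MeasurableSpace Ω] {P : Measure Ω} {d : ℕ}
  {X : Ω → EuclideanSpace ℝ (Fin d)} {b : Fin d → ℝ} {f : EuclideanSpace ℝ (Fin d) → ℝ}

lemma lt_expMomentBound_iff {t : ℝ} : (t : EReal) < expMomentBound P X b ↔
    ∃ t' : ℝ, t < t' ∧ 0 < t' ∧ ∀ k, Integrable (fun ω => Real.exp (t' * b k * |X ω k|)) P := by
  rw [expMomentBound, lt_biSup_iff]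
  constructor
  · rintro ⟨t', ⟨h1, h2⟩, h3⟩
    exact ⟨t', EReal.coe_lt_coe_iff.1 h3, h1, h2⟩
  · rintro ⟨t', h1, h2, h3⟩
    exact ⟨t', ⟨h2, h3⟩, EReal.coe_lt_coe_iff.2 h1⟩

lemma aemeasurable_coord_comp (hX : AEMeasurable X P) (k : Fin d) :
    AEMeasurable (fun ω => X ω k) P :=
  (measurable_coord k).comp_aemeasurable hX

lemma expMomentBound_pos (hX : AEMeasurable X P) (hb : ∀ k, 0 ≤ b k)
    (hexp : ∃ t : ℝ, 0 < t ∧ Integrable (fun ω => Real.exp (t * ‖X ω‖)) P) :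
    0 < expMomentBound P X b := by
  obtain ⟨t, ht, hi⟩ := hexp
  have hs : 0 ≤ ∑ k, b k := Finset.sum_nonneg fun k _ => hb k
  -- The added 1 keeps the denominator positive when all b_k vanish.
  have h1 : 0 < t / (1 + ∑ k, b k) := by positivity
  refine (lt_expMomentBound_iff (t := 0)).2 ⟨t / (1 + ∑ k, b k), h1, h1, fun k => ?_⟩
  have hbk : b k ≤ 1 + ∑ k, b k := by
    have := Finset.single_le_sum (fun k _ => hb k) (Finset.mem_univ k)
    linarith
  have h2 : t / (1 + ∑ k, b k) * b k ≤ t := by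
    rw [div_mul_eq_mul_div, div_le_iff₀ (by positivity)]
    exact mul_le_mul_of_nonneg_left hbk ht.le
  refine hi.mono' ?_ (ae_of_all _ fun ω => ?_)
  · have := (aemeasurable_coord_comp hX k).abs
    exact (Real.measurable_exp.comp_aemeasurable (this.const_mul _)).aestronglyMeasurable
  · rw [Real.norm_eq_abs, Real.abs_exp]
    exact Real.exp_le_exp.2 (mul_le_mul h2 (PiLp.norm_apply_le (X ω) k) (abs_nonneg _) ht.le)

lemma integrable_comp_of_coord_lipschitz [IsProbabilityMeasure P] (hX : AEMeasurable X P)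
    (hf : ∀ (k : Fin d) (u : ℝ) (x : EuclideanSpace ℝ (Fin d)),
      |f (x + u • EuclideanSpace.single k (1 : ℝ)) - f x| ≤ b k * |u|)
    (hexp : ∃ t : ℝ, 0 < t ∧ Integrable (fun ω => Real.exp (t * ‖X ω‖)) P) :
    Integrable (fun ω => f (X ω)) P := by
  obtain ⟨t, ht, hi⟩ := hexp
  have hfc := continuous_of_coord_lipschitz hf
  have hb := nonneg_of_coord_lipschitz hf
  refine ((integrable_const |f 0|).add (hi.const_mul ((∑ k, b k) * t⁻¹))).mono'
    (hfc.measurable.comp_aemeasurable hX).aestronglyMeasurable (ae_of_all _ fun ω => ?_)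
  have h1 := abs_sub_le_sum_of_coord_lipschitz hf 0 (X ω)
  have h2 : ∑ k, b k * |X ω k - (0 : EuclideanSpace ℝ (Fin d)) k| ≤ (∑ k, b k) * ‖X ω‖ := by
    rw [Finset.sum_mul]
    refine Finset.sum_le_sum fun k _ => mul_le_mul_of_nonneg_left ?_ (hb k)
    simpa using PiLp.norm_apply_le (X ω) k
  have h3 : ‖X ω‖ ≤ t⁻¹ * Real.exp (t * ‖X ω‖) := by
    rw [← div_eq_inv_mul, le_div_iff₀ ht]
    linarith [Real.add_one_le_exp (t * ‖X ω‖)]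
  have h4 := mul_le_mul_of_nonneg_left h3 (Finset.sum_nonneg fun k (_ : k ∈ Finset.univ) => hb k)
  have h5 : |f (X ω)| ≤ |f 0| + |f (X ω) - f 0| := by
    have := abs_add_le (f 0) (f (X ω) - f 0)
    rwa [add_sub_cancel] at this
  simp only [Pi.add_apply, Real.norm_eq_abs]
  rw [mul_assoc]
  linarith

/-- An upper limit above c is exceeded frequently near M, and M > 0 makes positive times available
there. -/
lemma exists_lt_of_lt_leftLimit {h : ℝ → ℝ≥0∞} {M : EReal} (hM : 0 < M) {c : ℝ≥0∞}
    (hc : c < leftLimit h M) : ∃ t : ℝ, 0 ≤ t ∧ (t : EReal) < M ∧ c < h t := by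
  have h1 := frequently_lt_of_lt_limsup (by isBoundedDefault) hc
  have h2 : ∀ᶠ t : ℝ in comap (fun t : ℝ => (t : EReal)) (𝓝[<] M), (t : EReal) < M :=
    preimage_mem_comap (self_mem_nhdsWithin : Iio M ∈ 𝓝[<] M)
  have h3 : ∀ᶠ t : ℝ in comap (fun t : ℝ => (t : EReal)) (𝓝[<] M), (0 : EReal) < (t : EReal) :=
    preimage_mem_comap (mem_nhdsWithin_of_mem_nhds (Ioi_mem_nhds hM))
  obtain ⟨t, ht1, ht2, ht3⟩ := (h1.and_eventually (h2.and h3)).exists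
  exact ⟨t, (EReal.coe_pos.1 ht3).le, ht2, ht1⟩

end Assembly

theorem corollary1 {Ω : Type*} [MeasurableSpace Ω] (P : Measure Ω) [IsProbabilityMeasure P]
    {d : ℕ} (X : Ω → EuclideanSpace ℝ (Fin d)) (γ : EuclideanSpace ℝ (Fin d))
    (ν : Measure (EuclideanSpace ℝ (Fin d)))
    (hX : IsIDVector P X γ ν)
    (hindep : iIndepFun (fun (k : Fin d) (ω : Ω) => X ω k) P)
    (hexp : ∃ t : ℝ, 0 < t ∧ Integrable (fun ω => Real.exp (t * ‖X ω‖)) P)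
    (f : EuclideanSpace ℝ (Fin d) → ℝ) (b : Fin d → ℝ)
    (hf : ∀ (k : Fin d) (u : ℝ) (x : EuclideanSpace ℝ (Fin d)),
      |f (x + u • EuclideanSpace.single k (1 : ℝ)) - f x| ≤ b k * |u|)
    (M : EReal) (hM : M = expMomentBound P X b)
    (D : Set ℝ) (hD : D = {t : ℝ | 0 ≤ t ∧ (t : EReal) < M})
    (h : ℝ → ℝ) (hh : h = fun t => (hfun ν b f t).toReal) :
    -- `M` is positive, `E f(X)` exists and `h_f` is finite on `[0, M)`
    0 < M ∧ Integrable (fun ω => f (X ω)) P ∧ (∀ t ∈ D, hfun ν b f t < ∞) ∧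
    -- the bound on the Laplace transform
    (∀ t ∈ D, IntervalIntegrable h volume 0 t ∧
      Integrable (fun ω => Real.exp (t * (f (X ω) - ∫ ω', f (X ω') ∂P))) P ∧
      ∫ ω, Real.exp (t * (f (X ω) - ∫ ω', f (X ω') ∂P)) ∂P ≤ Real.exp (∫ s in (0 : ℝ)..t, h s)) ∧
    -- the tail bound; the first three facts say that `h_f⁻¹` and its integral are well defined
    (∀ x : ℝ, 0 < x → ENNReal.ofReal x < leftLimit (hfun ν b f) M →
      InjOn h D ∧ Icc 0 x ⊆ h '' D ∧
      IntervalIntegrable (Function.invFunOn h D) volume 0 x ∧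
      P.real {ω | x ≤ f (X ω) - ∫ ω', f (X ω') ∂P} ≤
        Real.exp (-∫ s in (0 : ℝ)..x, Function.invFunOn h D s)) := by
  have hm := hX.aemeasurable
  have hb := nonneg_of_coord_lipschitz hf
  have hfc := continuous_of_coord_lipschitz hf
  have hM0 : 0 < M := hM ▸ expMomentBound_pos hm hb hexp
  have hfX : Integrable (fun ω => f (X ω)) P := integrable_comp_of_coord_lipschitz hm hf hexp
  have hfi : Integrable f (P.map X) :=
    (integrable_map_measure hfc.aestronglyMeasurable hm).2 hfX
  have hD0 : ∀ t ∈ D, 0 ≤ t := fun t ht => by rw [hD] at ht; exact ht.1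
  have h0D : (0 : ℝ) ∈ D := by rw [hD]; exact ⟨le_rfl, hM0⟩
  have hDM : ∀ t : ℝ, 0 ≤ t → (t : EReal) < M → t ∈ D := fun t h1 h2 => by rw [hD]; exact ⟨h1, h2⟩
  have hDlt : ∀ t ∈ D, ∃ t', t < t' ∧ 0 < t' ∧
      ∀ k, Integrable (fun ω => Real.exp (t' * b k * |X ω k|)) P := fun t ht => by
    rw [hD] at ht
    have := ht.2
    rw [hM] at this
    exact lt_expMomentBound_iff.1 this
  have hDicc : ∀ t ∈ D, Icc 0 t ⊆ D := fun t ht s hs => by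
    rw [hD] at ht
    exact hDM s hs.1 ((EReal.coe_le_coe_iff.2 hs.2).trans_lt ht.2)
  have hDconv : Convex ℝ D :=
    OrdConnected.convex ⟨fun s hs t ht r hr => hDicc t ht ⟨(hD0 s hs).trans hr.1, hr.2⟩⟩
  -- The supremum M is not attained in D, so that there is always room to the right, as continuity
  -- requires.
  have hDopen : ∀ t ∈ D, ∃ t' ∈ D, t < t' := fun t ht => by
    obtain ⟨t', h1, h2, h3⟩ := hDlt t ht
    obtain ⟨s, hs1, hs2⟩ := exists_between h1
    exact ⟨s, hDM s ((hD0 t ht).trans hs1.le) (hM ▸ lt_expMomentBound_iff.2 ⟨t', hs2, h2, h3⟩),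
      hs1⟩
  have hfin : ∀ t ∈ D, hfun ν b f t < ∞ := fun t ht => by
    obtain ⟨t', h1, _, h3⟩ := hDlt t ht
    exact hX.hfun_lt_top hindep hf (hD0 t ht) h1 h3
  have hconv : ConvexOn ℝ D h := hh ▸ convexOn_toReal_hfun hfc hb hDconv hD0 hfin
  have hz : h 0 = 0 := by rw [hh]; simp [hfun_zero]
  have hnn : ∀ t ∈ D, 0 ≤ h t := fun t _ => by rw [hh]; exact ENNReal.toReal_nonneg
  have hcont : ContinuousOn h D := hconv.continuousOn_of_zero h0D hz hD0 hnn hDopen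
  have hlap : ∀ t ∈ D, IntervalIntegrable h volume 0 t ∧
      Integrable (fun ω => Real.exp (t * (f (X ω) - ∫ ω', f (X ω') ∂P))) P ∧
      ∫ ω, Real.exp (t * (f (X ω) - ∫ ω', f (X ω') ∂P)) ∂P ≤
        Real.exp (∫ s in (0 : ℝ)..t, h s) := by
    intro t ht
    have ht0 := hD0 t ht
    have hci : ContinuousOn h (Icc 0 t) := hcont.mono (hDicc t ht)
    have hEf : ∫ ω', f (X ω') ∂P = ∫ z, f z ∂(P.map X) :=
      (integral_map hm hfc.aestronglyMeasurable).symm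
    have hec : Continuous fun x => Real.exp (t * (f x - ∫ z, f z ∂(P.map X))) := by fun_prop
    obtain ⟨i1, i2⟩ := hX.integral_exp_le hindep hf hfi ht0
      (fun s hs => hfin s (hDicc t ht hs)) (by
        have := hci.integrableOn_Icc (μ := volume)
        rwa [hh] at this)
    refine ⟨ContinuousOn.intervalIntegrable (by rwa [uIcc_of_le ht0]), ?_, ?_⟩
    · rw [hEf]
      exact (integrable_map_measure hec.aestronglyMeasurable hm).1 i1
    · rw [integral_map hm hec.aestronglyMeasurable] at i2
      rw [hEf, hh]
      exact i2
  refine ⟨hM0, hfX, hfin, hlap, fun x hx hxlt => ?_⟩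
  obtain ⟨t, ht0, htM, hxt⟩ := exists_lt_of_lt_leftLimit hM0 hxlt
  have htD : t ∈ D := hDM t ht0 htM
  -- A zero at some s > 0 would make h_f vanish identically, contradicting x < h_f(t).
  have hpos : ∀ s ∈ D, 0 < s → 0 < h s := fun s hs hs0 => by
    refine lt_of_le_of_ne (hnn s hs) fun heq => ?_
    rw [hh] at heq
    have h1 : hfun ν b f s = 0 := by
      rcases (ENNReal.toReal_eq_zero_iff _).1 heq.symm with h2 | h2
      · exact h2
      · exact absurd h2 (hfin s hs).ne
    rw [hfun_eq_zero_of_eq_zero hfc hb hs0 h1 t] at hxt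
    exact not_lt_zero hxt
  have hstrict : StrictMonoOn h D := hconv.strictMonoOn_of_zero h0D hz hD0 hpos
  have hxh : x ≤ h t := by
    rw [hh]
    exact ((ENNReal.ofReal_lt_iff_lt_toReal hx.le (hfin t htD).ne).1 hxt).le
  have hIVT : Icc 0 (h t) ⊆ h '' Icc 0 t := by
    have := intermediate_value_Icc ht0 (hcont.mono (hDicc t htD))
    rwa [hz] at this
  -- The optimal Chernoff parameter: the derivative h(τ) - x of the exponent vanishes.
  obtain ⟨τ, hτ, hτx⟩ := hIVT ⟨hx.le, hxh⟩
  have hτD : τ ∈ D := hDicc t htD hτ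
  obtain ⟨hgi, hgint⟩ := integral_leftInverse_eq hτ.1 (hcont.mono (hDicc τ hτD))
    (hstrict.mono (hDicc τ hτD)) hz hτx
    (fun r hr => hstrict.injOn.leftInvOn_invFunOn (hDicc τ hτD hr))
  refine ⟨hstrict.injOn, fun s hs => ?_, hgi, ?_⟩
  · obtain ⟨r, hr, hrs⟩ := hIVT ⟨hs.1, hs.2.trans hxh⟩
    exact ⟨r, hDicc t htD hr, hrs⟩
  · obtain ⟨_, i1, i2⟩ := hlap τ hτD
    refine (measure_ge_le_exp_mul_mgf (X := fun ω => f (X ω) - ∫ ω', f (X ω') ∂P) x hτ.1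
      i1).trans ?_
    refine (mul_le_mul_of_nonneg_left i2 (Real.exp_pos _).le).trans_eq ?_
    -- The Chernoff exponent -τx + ∫₀^τ h is minus the integral of the inverse over [0, x].
    rw [← Real.exp_add, hgint]
    ring_nf
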